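/- Let $\overline{\mathbb D}\subset\mathbb C$ be the closed unit disc, $\mathbb D$ its interior, $\omega_{FS}$ the Fubini–Study form on $\mathbb P^1$, given by $\omega_{FS}=dd^c\log(1+|\zeta|^2)$ in each of the coordinates $\zeta=z$ and $\zeta=w=1/z$, and $\pi:\mathbb P^1\times\overline{\mathbb D}\to\mathbb P^1$ the projection. For a smooth family $(\phi_\tau)_{\tau\in\partial\mathbb D}$ of Kähler potentials (the function $(x,\tau)\mapsto\phi_\tau(x)$ is smooth on $\mathbb P^1\times\partial\mathbb D$ and $\omega_{FS}+dd^c\phi_\tau>0$ for each $\tau$), the weak solution $\Phi$ of the Dirichlet problem for the homogeneous complex Monge–Ampère equation (HMAE) $$\Phi(\cdot,\tau)=\phi_\tau\ \ (\tau\in\partial\mathbb D),\qquad \pi^*\omega_{FS}+dd^c\Phi\ge 0,\qquad (\pi^*\omega_{FS}+dd^c\Phi)^2=0$$ is the upper envelope of all upper semicontinuous $\psi:\mathbb P^1\times\overline{\mathbb D}\to\mathbb R\cup\{-\infty\}$ such that $\pi^*\omega_{FS}+dd^c\psi\ge 0$ on $\mathbb P^1\times\mathbb D$ and $\psi(\cdot,\tau)\le\phi_\tau$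 for all $\tau\in\partial\mathbb D$. **Theorem.** There exists a smooth family of Kähler potentials $(\phi_\tau)_{\tau\in\partial\mathbb D}$ on $(\mathbb P^1,\omega_{FS})$ such that the weak solution $\Phi$ of the HMAE with this boundary data (a real-valued upper semicontinuous function on $\mathbb P^1\times\overline{\mathbb D}$ that satisfies $\pi^*\omega_{FS}+dd^c\Phi\ge0$ on $\mathbb P^1\times\mathbb D$ and takes the boundary values $\phi_\tau$) is completely degenerate on some non-empty open subset $S\subset\mathbb P^1\times\mathbb D$, i.e. $$\pi^*\omega_{FS}+dd^c\Phi\,|_S=0 \quad\text{as a current.}$$ Moreover $\Phi$ does not have maximal rank, i.e. it is not true that for every $\tau\in\overline{\mathbb D}$ the current $\omega_{FS}+dd^c\Phi(\cdot,\tau)$ on $\mathbb P^1$ is strictly positive (bounded below by $\varepsilon\,\omega_{FS}$ for some $\varepsilon>0$); and $\pi^*\omega_{FS}+dd^c\Phi$ is not identically zero on $\mathbb P^1\times\mathbb D$, so that it does not have constant rank either. -/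

import Mathlib

open scoped ContDiff Topology

noncomputable section

namespace HMAE

/-- The complex projective line, as the Riemann sphere `ℂ ∪ {∞}` with its usual topology. -/
abbrev P1 : Type := OnePoint ℂ

/-- The affine coordinate `z`. -/
def chartZ (z : ℂ) : P1 := (z : OnePoint ℂ)

/-- The affine coordinate `w = 1 / z`; the point `w = 0` is `z = ∞`. -/
def chartW (w : ℂ) : P1 := if w = 0 then OnePoint.infty else ((w⁻¹ : ℂ) : OnePoint ℂ)

/-- The standard cover of `P1` by two copies of `ℂ`. -/
def charts : Set (ℂ → P1) := {chartZ, chartW}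

/-- The local potential `log (1 + |ζ|²)` of the Fubini-Study form; it has the same expression in
both coordinates, and `ω_FS = dd^c log (1 + |ζ|²)`. -/
def fsPotential (ζ : ℂ) : ℝ := Real.log (1 + ‖ζ‖ ^ 2)

/-- Kähler potentials on `(P1, ω_FS)`: smooth real functions `f` with `ω_FS + dd^c f > 0`. In each
coordinate, `ω_FS + dd^c f` is a positive constant times the Laplacian of the local potential
`log (1 + |ζ|²) + f`. -/
def IsKahlerPotential (f : P1 → ℝ) : Prop :=
  ∀ c ∈ charts, ContDiff ℝ ∞ (fun ζ : ℂ => f (c ζ)) ∧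
    ∀ ζ : ℂ, 0 < Laplacian.laplacian (fun ξ : ℂ => fsPotential ξ + f (c ξ)) ζ

/-- The function `(τ, x) ↦ φ τ x` is smooth on the product of the unit circle and `P1`. -/
def IsSmoothFamily (φ : Circle → P1 → ℝ) : Prop :=
  ∀ c ∈ charts, ContDiff ℝ ∞ (fun q : ℝ × ℂ => φ (Circle.exp q.1) (c q.2))

/-- Plurisubharmonic functions `u : U → ℝ ∪ {-∞}` on an open set `U` (for `E = ℂ`: subharmonic
functions; the constant `-∞` is allowed): `u` is upper semicontinuous, and `u a` is at most the
mean of `u` over the boundary of every closed complex disc `{a + ζ b : |ζ| ≤ 1}` in `U`.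
Since `u` is upper semicontinuous and bounded above on the boundary circle, its mean there (which
may be `-∞`) is the infimum of the means of the continuous functions `g ≥ u` on the circle. -/
def IsPlurisubharmonicOn {E : Type*} [NormedAddCommGroup E] [NormedSpace ℂ E]
    (u : E → EReal) (U : Set E) : Prop :=
  UpperSemicontinuousOn u U ∧ (∀ p ∈ U, u p ≠ ⊤) ∧
    ∀ a b : E, (∀ ζ : ℂ, ‖ζ‖ ≤ 1 → a + ζ • b ∈ U) →
      ∀ g : ℂ → ℝ, ContinuousOn g (Metric.sphere 0 1) →
        (∀ ζ ∈ Metric.sphere (0 : ℂ) 1, u (a + ζ • b) ≤ (g ζ : EReal)) →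
          u a ≤ ((Real.circleAverage g 0 1 : ℝ) : EReal)

/-- `P1 × closed unit disc`, as a subset of `P1 × ℂ`. -/
def closedProduct : Set (P1 × ℂ) := Set.univ ×ˢ Metric.closedBall 0 1

/-- `P1 × open unit disc`, as a subset of `P1 × ℂ`. -/
def openProduct : Set (P1 × ℂ) := Set.univ ×ˢ Metric.ball 0 1

/-- The candidates `ψ : P1 × closed disc → ℝ ∪ {-∞}` for the envelope: `ψ` is upper semicontinuous,
`π^* ω_FS + dd^c ψ ≥ 0` on `P1 × open disc` (the local potentials `log (1 + |ζ|²) + ψ` are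
plurisubharmonic), and `ψ (·, τ) ≤ φ_τ` for `|τ| = 1`. Only the values of `ψ` on `closedProduct`
matter. -/
structure IsCandidate (φ : Circle → P1 → ℝ) (ψ : P1 × ℂ → EReal) : Prop where
  usc : UpperSemicontinuousOn ψ closedProduct
  ne_top : ∀ p ∈ closedProduct, ψ p ≠ ⊤
  psh : ∀ c ∈ charts, IsPlurisubharmonicOn
    (fun q : ℂ × ℂ => (fsPotential q.1 : EReal) + ψ (c q.1, q.2)) (Set.univ ×ˢ Metric.ball 0 1)
  boundary_le : ∀ (τ : Circle) (x : P1), ψ (x, (τ : ℂ)) ≤ (φ τ x : EReal)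

/-- The upper envelope of all candidates. -/
def envelope (φ : Circle → P1 → ℝ) (p : P1 × ℂ) : EReal :=
  ⨆ (ψ : P1 × ℂ → EReal) (_ : IsCandidate φ ψ), ψ p

/-- The (unique) weak solution `Φ` on `P1 × closed disc` of the Dirichlet problem for the
homogeneous complex Monge-Ampère equation with boundary data `φ`: it is the upper envelope of the
candidates, it is itself a candidate (so it is upper semicontinuous and
`π^* ω_FS + dd^c Φ ≥ 0`), and it takes the boundary values `φ`. -/
structure IsWeakSolution (φ : Circle → P1 → ℝ) (Φ : P1 × ℂ → ℝ) : Prop where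
  eq_envelope : ∀ p ∈ closedProduct, (Φ p : EReal) = envelope φ p
  candidate : IsCandidate φ (fun p => (Φ p : EReal))
  boundary_eq : ∀ (τ : Circle) (x : P1), Φ (x, (τ : ℂ)) = φ τ x

/-- Up to a positive constant, `dd^c χ (b, i b)` at `p`: the Laplacian at `ζ = 0` of the
restriction of `χ` to the complex line `ζ ↦ p + ζ b`. -/
def leviForm (χ : ℂ × ℂ → ℝ) (p b : ℂ × ℂ) : ℝ :=
  Laplacian.laplacian (fun ζ : ℂ => χ (p + ζ • b)) 0

/-- The current `π^* ω_FS + dd^c Φ` vanishes on the open set `S`. In coordinates, the local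
potential `u = log (1 + |ζ|²) + Φ` is locally integrable and `dd^c u = 0` in the sense of
distributions, i.e. `∫ u · dd^c χ (b, i b) = 0` for all test functions `χ` supported in `S` and all
constant vectors `b` (by polarization these give all coefficients of the current). -/
def CurrentVanishesOn (Φ : P1 × ℂ → ℝ) (S : Set (P1 × ℂ)) : Prop :=
  ∀ c ∈ charts,
    MeasureTheory.LocallyIntegrableOn
      (fun q : ℂ × ℂ => fsPotential q.1 + Φ (c q.1, q.2)) {q | (c q.1, q.2) ∈ S} ∧
    ∀ χ : ℂ × ℂ → ℝ, ContDiff ℝ ∞ χ → HasCompactSupport χ →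
      tsupport χ ⊆ {q | (c q.1, q.2) ∈ S} →
        ∀ b : ℂ × ℂ, ∫ q : ℂ × ℂ, (fsPotential q.1 + Φ (c q.1, q.2)) * leviForm χ q b = 0

/-- The current `ω_FS + dd^c f` on `P1` is strictly positive: it is at least `ε ω_FS` for some
`ε > 0`, i.e. the local potentials of `(1 - ε) ω_FS + dd^c f` are subharmonic. -/
def IsStrictlyPositive (f : P1 → ℝ) : Prop :=
  ∃ ε : ℝ, 0 < ε ∧ ∀ c ∈ charts, IsPlurisubharmonicOn
    (fun ζ : ℂ => (((1 - ε) * fsPotential ζ + f (c ζ) : ℝ) : EReal)) Set.univ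

/-- The current `π^* ω_FS + dd^c Φ` has maximal rank (in the fibre directions): its restriction
`ω_FS + dd^c Φ(·, τ)` to every fibre is strictly positive. -/
def HasMaximalRank (Φ : P1 × ℂ → ℝ) : Prop :=
  ∀ τ ∈ Metric.closedBall (0 : ℂ) 1, IsStrictlyPositive (fun x => Φ (x, τ))

end HMAE

end

namespace HMAE

/-! Write `v(w, τ) = log(1 + |w|²) + Φ` for the local potential of the solution in the coordinate `w
= 1/z`. The boundary data are one fixed potential rotated with `τ`: on `|τ| = 1` the local potential
is `H(w τ⁻¹)`, where `H ≥ 0` is strictly subharmonic, equals the Fubini–Study potential away from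
the origin, and vanishes on a real segment `[-2ρ, 2ρ]` (`exists_profile`). So the boundary potential
vanishes on the segments `τ·[-2ρ, 2ρ]`, which make a full turn as `τ` does.

Upper bound. For `|e| = ρ` the holomorphic disc `τ ↦ (e + ē τ², τ)` has its boundary on these
segments, because `e + ē τ² = 2 Re(e τ̄) τ` when `|τ| = 1`. The maximum principle gives `v ≤ 0` on
the disc (`le_zero_on_quadratic_disc`). For fixed `τ` inside, the points `e + ē τ²` trace an
ellipse, and the maximum principle in the fibre gives `v ≤ 0` inside it (`le_zero_in_ellipse`), in
particular for `|w| ≤ ρ(1 - |τ|²)`.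

Lower bound. For `0 < δ ≤ 1` the `τ`-independent function with local potential `log(1 + δ|w|²) -
log(1 + δ)` is a candidate. Letting `δ → 0` gives `v ≥ 0` everywhere, so `v = 0` on an open set
around `w = 0`. The current vanishes there, and the fibre over `τ = 0` violates maximal rank. Taking
`δ = 1` gives `v > 0` for `|w| > 1`; since `v` is nonnegative and vanishes near `w = 0`, a test
function with positive Laplacian outside the zero disc shows that the current is not zero globally
(`not_weakly_harmonic`).

That the envelope is a genuine weak solution is Perron's method: Lipschitz dependence on `τ` yields
pluriharmonic barriers at each boundary point, and the regularized envelope is itself a candidate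
(`exists_isWeakSolution`). -/

theorem laplacian_eq_fderiv (g : ℂ → ℝ) (x : ℂ) :
    Laplacian.laplacian g x = fderiv ℝ (fderiv ℝ g) x 1 1
      + fderiv ℝ (fderiv ℝ g) x Complex.I Complex.I := by
  have h := congrFun (InnerProductSpace.laplacian_eq_iteratedFDeriv_complexPlane g) x
  rw [h, iteratedFDeriv_two_apply, iteratedFDeriv_two_apply]
  simp

/-! ### Second derivatives along lines and the Laplacian under holomorphic maps. -/

section LineDerivative

variable {E : Type*} [NormedAddCommGroup E] [NormedSpace ℝ E]

theorem hasDerivAt_line (x v : E) (t : ℝ) : HasDerivAt (fun s : ℝ => x + s • v) v t := by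
  simpa using ((hasDerivAt_id t).smul_const v).const_add x

theorem tendsto_line (x v : E) : Filter.Tendsto (fun s : ℝ => x + s • v) (𝓝 0) (𝓝 x) := by
  have := (hasDerivAt_line x v 0).continuousAt.tendsto
  simpa using this

theorem eventually_hasDerivAt_comp_line {g : E → ℝ} {x : E} (hg : ContDiffAt ℝ 2 g x) (v : E) :
    ∀ᶠ t : ℝ in 𝓝 0, HasDerivAt (fun s : ℝ => g (x + s • v)) (fderiv ℝ g (x + t • v) v) t := by
  have h1 : ∀ᶠ y in 𝓝 x, DifferentiableAt ℝ g y := by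
    filter_upwards [hg.eventually (by simp)] with y hy
    exact hy.differentiableAt (by simp)
  filter_upwards [(tendsto_line x v).eventually h1] with t ht
  exact ht.hasFDerivAt.comp_hasDerivAt t (hasDerivAt_line x v t)

theorem hasDerivAt_fderiv_comp_line {g : E → ℝ} {x : E} (hg : ContDiffAt ℝ 2 g x) (v : E) :
    HasDerivAt (fun t : ℝ => fderiv ℝ g (x + t • v) v) (fderiv ℝ (fderiv ℝ g) x v v) 0 := by
  have h2 : DifferentiableAt ℝ (fderiv ℝ g) x :=
    (hg.fderiv_right (m := 1) (by norm_num)).differentiableAt (by simp)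
  have h3 : HasFDerivAt (fderiv ℝ g) (fderiv ℝ (fderiv ℝ g) x) (x + (0 : ℝ) • v) := by
    simpa using h2.hasFDerivAt
  have h4 := h3.comp_hasDerivAt (0 : ℝ) (hasDerivAt_line x v 0)
  have h5 := h4.clm_apply (hasDerivAt_const (0 : ℝ) v)
  simpa using h5

/-- The second derivative in direction `v` can be computed along the line through `x`. -/
theorem fderiv_fderiv_eq_of_line {g : E → ℝ} {x v : E} (hg : ContDiffAt ℝ 2 g x) {g₁ : ℝ → ℝ}
    {c : ℝ} (h₁ : ∀ᶠ t : ℝ in 𝓝 0, HasDerivAt (fun s : ℝ => g (x + s • v)) (g₁ t) t)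
    (h₂ : HasDerivAt g₁ c 0) : fderiv ℝ (fderiv ℝ g) x v v = c := by
  have h : g₁ =ᶠ[𝓝 0] fun t : ℝ => fderiv ℝ g (x + t • v) v := by
    filter_upwards [h₁, eventually_hasDerivAt_comp_line hg v] with t a b using a.unique b
  exact (hasDerivAt_fderiv_comp_line hg v).unique (h₂.congr_of_eventuallyEq h.symm)

end LineDerivative

theorem contDiffAt_real_of_analyticAt {f : ℂ → ℂ} {z : ℂ} (hf : AnalyticAt ℂ f z) {n : WithTop ℕ∞} :
    ContDiffAt ℝ n f z :=
  (hf.contDiffAt (n := n)).restrict_scalars ℝ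

/-- The second-order chain rule along a line. The first-order term carries `v² f''`, so it cancels
when the directions `1` and `I` are summed. -/
theorem fderiv_fderiv_comp_analytic {g : ℂ → ℝ} {f : ℂ → ℂ} {z : ℂ} (hf : AnalyticAt ℂ f z)
    (hg : ContDiffAt ℝ 2 g (f z)) (v : ℂ) :
    fderiv ℝ (fderiv ℝ (g ∘ f)) z v v =
      fderiv ℝ (fderiv ℝ g) (f z) (v * deriv f z) (v * deriv f z)
        + fderiv ℝ g (f z) (v * (v * deriv (deriv f) z)) := by
  have hgf : ContDiffAt ℝ 2 (g ∘ f) z := hg.comp z (contDiffAt_real_of_analyticAt hf)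
  have hline : ∀ {k : ℂ → ℂ} {x : ℂ} (t : ℝ), x = z + t • v → DifferentiableAt ℂ k x →
      HasDerivAt (fun s : ℝ => k (z + s • v)) (v * deriv k x) t := by
    intro k x t hx hk
    subst hx
    have := hk.hasDerivAt.scomp t (hasDerivAt_line z v t)
    simpa [Function.comp_def] using this
  refine fderiv_fderiv_eq_of_line hgf
    (g₁ := fun t => fderiv ℝ g (f (z + t • v)) (v * deriv f (z + t • v))) ?_ ?_
  · have e1 : ∀ᶠ y in 𝓝 z, DifferentiableAt ℂ f y ∧ DifferentiableAt ℝ g (f y) := by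
      have := hf.continuousAt.eventually (hg.eventually (by simp))
      filter_upwards [hf.eventually_analyticAt, this] with y h1 h2
      exact ⟨h1.differentiableAt, h2.differentiableAt (by simp)⟩
    filter_upwards [(tendsto_line z v).eventually e1] with t ht
    exact ht.2.hasFDerivAt.comp_hasDerivAt t (hline t rfl ht.1)
  · have h2 : DifferentiableAt ℝ (fderiv ℝ g) (f z) :=
      (hg.fderiv_right (m := 1) (by norm_num)).differentiableAt (by simp)
    have hz : z = z + (0 : ℝ) • v := by simp
    have h3 : HasFDerivAt (fderiv ℝ g) (fderiv ℝ (fderiv ℝ g) (f z)) (f (z + (0 : ℝ) • v)) := by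
      simpa using h2.hasFDerivAt
    have h4 := h3.comp_hasDerivAt (0 : ℝ) (hline 0 hz hf.differentiableAt)
    have h5 := (hline 0 hz hf.deriv.differentiableAt).const_mul v
    simpa using h4.clm_apply h5

/-- The Laplacian is conformally covariant. -/
theorem laplacian_comp_analytic {g : ℂ → ℝ} {f : ℂ → ℂ} {z : ℂ} (hf : AnalyticAt ℂ f z)
    (hg : ContDiffAt ℝ 2 g (f z)) :
    Laplacian.laplacian (g ∘ f) z = ‖deriv f z‖ ^ 2 * Laplacian.laplacian g (f z) := by
  rw [laplacian_eq_fderiv, laplacian_eq_fderiv, fderiv_fderiv_comp_analytic hf hg,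
    fderiv_fderiv_comp_analytic hf hg]
  set a := deriv f z
  set B := fderiv ℝ (fderiv ℝ g) (f z)
  set c := deriv (deriv f) z
  have e1 : (1 : ℂ) * a = a.re • (1 : ℂ) + a.im • Complex.I := by
    simp [Complex.re_add_im]
  have e2 : Complex.I * a = (-a.im) • (1 : ℂ) + a.re • Complex.I := by
    apply Complex.ext <;> simp
  have e3 : Complex.I * (Complex.I * c) = -((1 : ℂ) * (1 * c)) := by
    rw [← mul_assoc, Complex.I_mul_I]; simp
  rw [e3, map_neg, e1, e2, ← Complex.normSq_eq_norm_sq, Complex.normSq_apply]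
  simp only [map_add, map_smul, add_apply,
    smul_apply, smul_eq_mul]
  ring

/-! ### The sub-mean value inequality for smooth functions. -/

theorem hasDerivAt_intervalIntegral_of_continuous {F F' : ℝ → ℝ → ℝ} {a b : ℝ}
    (hF : Continuous (Function.uncurry F)) (hF' : Continuous (Function.uncurry F'))
    (h : ∀ s θ, HasDerivAt (fun s => F s θ) (F' s θ) s) (s₀ : ℝ) :
    HasDerivAt (fun s => ∫ θ in a..b, F s θ) (∫ θ in a..b, F' s₀ θ) s₀ := by
  have hK : IsCompact (Metric.closedBall s₀ 1 ×ˢ Set.uIcc a b) :=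
    (isCompact_closedBall s₀ 1).prod isCompact_uIcc
  obtain ⟨C, hC⟩ := hK.exists_bound_of_continuousOn hF'.continuousOn
  refine (intervalIntegral.hasDerivAt_integral_of_dominated_loc_of_deriv_le (bound := fun _ => C)
    (Metric.ball_mem_nhds s₀ one_pos) ?_ ?_ ?_ ?_ ?_ ?_).2
  · refine Filter.Eventually.of_forall fun s => ?_
    exact (hF.comp (Continuous.prodMk_right s)).aestronglyMeasurable
  · exact (hF.comp (Continuous.prodMk_right s₀)).intervalIntegrable _ _
  · exact (hF'.comp (Continuous.prodMk_right s₀)).aestronglyMeasurable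
  · refine Filter.Eventually.of_forall fun θ hθ s hs => ?_
    exact hC (s, θ) ⟨Metric.ball_subset_closedBall hs, Set.uIoc_subset_uIcc hθ⟩
  · simp
  · exact Filter.Eventually.of_forall fun θ _ s _ => h s θ

/-- If `B` dropped below its limit, some secant would have negative slope; by convexity `B` stays
above that secant to its left and tends to `+∞` at `-∞`. -/
theorem le_of_convexOn_of_tendsto_atBot {B : ℝ → ℝ} {l : ℝ} (hB : ConvexOn ℝ Set.univ B)
    (hl : Filter.Tendsto B Filter.atBot (𝓝 l)) (x : ℝ) : l ≤ B x := by
  by_contra! hx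
  obtain ⟨s, hs, hsx⟩ : ∃ s, B x < B s ∧ s < x :=
    ((hl.eventually (lt_mem_nhds hx)).and (Filter.eventually_lt_atBot x)).exists
  have key : ∀ r < s, B s + (B s - B x) / (x - s) * (s - r) ≤ B r := by
    intro r hr
    have h := hB.slope_mono_adjacent (Set.mem_univ r) (Set.mem_univ x) hr hsx
    rw [div_le_iff₀ (by linarith)] at h
    have : (B x - B s) / (x - s) * (s - r) = -((B s - B x) / (x - s) * (s - r)) := by ring
    linarith
  have hm : 0 < (B s - B x) / (x - s) := div_pos (by linarith) (by linarith)
  have h1 : Filter.Tendsto (fun r => B s + (B s - B x) / (x - s) * (s - r)) Filter.atBot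
      Filter.atTop := by
    refine Filter.tendsto_atTop_add_const_left _ _ (Filter.Tendsto.const_mul_atTop hm ?_)
    exact (Filter.tendsto_atTop_add_const_left _ s Filter.tendsto_neg_atBot_atTop).congr
      fun r => (sub_eq_add_neg s r).symm
  have h2 : Filter.Tendsto B Filter.atBot Filter.atTop := by
    refine Filter.tendsto_atTop_mono' _ ?_ h1
    filter_upwards [Filter.eventually_lt_atBot s] with r hr using key r hr
  exact not_tendsto_nhds_of_tendsto_atTop h2 l hl

/-- The sub-mean value inequality for `C²` functions with nonnegative Laplacian. -/
theorem le_circleAverage_of_laplacian_nonneg {g : ℂ → ℝ} (hg : ContDiff ℝ 2 g)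
    (hΔ : ∀ z, 0 ≤ Laplacian.laplacian g z) : g 0 ≤ Real.circleAverage g 0 1 := by
  -- In the logarithmic coordinate, circles around `0` become vertical periods. The integral of `k`
  -- over a period is a convex function of `s = log r` with limit `2π g(0)` at `-∞`, so its value at
  -- `s = 0` is at least that limit.
  set k : ℂ → ℝ := g ∘ Complex.exp with hk
  have hexp : ∀ z, AnalyticAt ℂ Complex.exp z := fun z => Complex.differentiable_exp.analyticAt z
  have hkC : ContDiff ℝ 2 k := hg.comp (Complex.contDiff_exp (𝕜 := ℝ))
  have hkΔ : ∀ z, 0 ≤ Laplacian.laplacian k z := fun z => by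
    rw [hk, laplacian_comp_analytic (hexp z) hg.contDiffAt]
    exact mul_nonneg (sq_nonneg _) (hΔ _)
  have hper : ∀ z, k (z + 2 * Real.pi * Complex.I) = k z := fun z => by
    simp [hk, Complex.exp_periodic z]
  have hC1 : Continuous (fderiv ℝ k) := (hkC.fderiv_right (m := 1) (by norm_num)).continuous
  have hC2 : Continuous (fderiv ℝ (fderiv ℝ k)) :=
    ((hkC.fderiv_right (m := 1) (by norm_num)).fderiv_right (m := 0) (by norm_num)).continuous
  have hd1 : ∀ z, HasFDerivAt k (fderiv ℝ k z) z := fun z =>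
    (hkC.differentiable (by simp) z).hasFDerivAt
  have hd2 : ∀ z, HasFDerivAt (fderiv ℝ k) (fderiv ℝ (fderiv ℝ k) z) z := fun z =>
    ((hkC.fderiv_right (m := 1) (by norm_num)).differentiable (by simp) z).hasFDerivAt
  have hcont : Continuous fun p : ℝ × ℝ => ((p.1 : ℂ) + p.2 * Complex.I) := by fun_prop
  have hls : ∀ s θ : ℝ, HasDerivAt (fun s : ℝ => (s : ℂ) + θ * Complex.I) 1 s := fun s θ =>
    (Complex.ofRealCLM.hasDerivAt).add_const _
  have hlθ : ∀ s θ : ℝ, HasDerivAt (fun θ : ℝ => (s : ℂ) + θ * Complex.I) Complex.I θ :=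
    fun s θ => by
      simpa using ((Complex.ofRealCLM.hasDerivAt (x := θ)).mul_const Complex.I).const_add (s : ℂ)
  set B : ℝ → ℝ := fun s => ∫ θ in (0 : ℝ)..2 * Real.pi, k (s + θ * Complex.I) with hB
  have hB1 : ∀ s : ℝ, HasDerivAt B
      (∫ θ in (0 : ℝ)..2 * Real.pi, fderiv ℝ k (s + θ * Complex.I) 1) s := fun s =>
    hasDerivAt_intervalIntegral_of_continuous (F := fun s θ => k (s + θ * Complex.I))
      (F' := fun s θ => fderiv ℝ k (s + θ * Complex.I) 1)
      (hkC.continuous.comp hcont) ((hC1.comp hcont).clm_apply continuous_const)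
      (fun s θ => (hd1 _).comp_hasDerivAt s (hls s θ)) s
  have hB2 : ∀ s : ℝ, HasDerivAt
      (fun s : ℝ => ∫ θ in (0 : ℝ)..2 * Real.pi, fderiv ℝ k (s + θ * Complex.I) 1)
      (∫ θ in (0 : ℝ)..2 * Real.pi, fderiv ℝ (fderiv ℝ k) (s + θ * Complex.I) 1 1) s := fun s =>
    hasDerivAt_intervalIntegral_of_continuous
      (F := fun s θ => fderiv ℝ k (s + θ * Complex.I) 1)
      (F' := fun s θ => fderiv ℝ (fderiv ℝ k) (s + θ * Complex.I) 1 1)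
      ((hC1.comp hcont).clm_apply continuous_const)
      (((hC2.comp hcont).clm_apply continuous_const).clm_apply continuous_const)
      (fun s θ => by
        simpa using ((hd2 _).comp_hasDerivAt s (hls s θ)).clm_apply (hasDerivAt_const s (1 : ℂ))) s
  have hperd : ∀ z, fderiv ℝ k (z + 2 * Real.pi * Complex.I) = fderiv ℝ k z := fun z => by
    rw [← fderiv_comp_add_right]
    simp_rw [hper]
  -- By periodicity the second angular derivative integrates to zero, so `B''` is the integral of
  -- the full Laplacian.
  have hII : ∀ s : ℝ, ∫ θ in (0 : ℝ)..2 * Real.pi,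
      fderiv ℝ (fderiv ℝ k) (s + θ * Complex.I) Complex.I Complex.I = 0 := fun s => by
    have hcs : Continuous fun θ : ℝ => (s : ℂ) + θ * Complex.I := by fun_prop
    rw [intervalIntegral.integral_eq_sub_of_hasDerivAt
      (f := fun θ : ℝ => fderiv ℝ k (s + θ * Complex.I) Complex.I)]
    · have := hperd s
      simp [this]
    · intro θ _
      simpa using
        ((hd2 _).comp_hasDerivAt θ (hlθ s θ)).clm_apply (hasDerivAt_const θ Complex.I)
    · exact (((hC2.comp hcs).clm_apply continuous_const).clm_apply
        continuous_const).intervalIntegrable _ _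
  have hpos : ∀ s : ℝ,
      0 ≤ ∫ θ in (0 : ℝ)..2 * Real.pi, fderiv ℝ (fderiv ℝ k) (s + θ * Complex.I) 1 1 := fun s => by
    have hcs : Continuous fun θ : ℝ => (s : ℂ) + θ * Complex.I := by fun_prop
    have hi : ∀ v : ℂ, IntervalIntegrable
        (fun θ : ℝ => fderiv ℝ (fderiv ℝ k) (s + θ * Complex.I) v v) MeasureTheory.volume
        0 (2 * Real.pi) := fun v =>
      (((hC2.comp hcs).clm_apply continuous_const).clm_apply
        continuous_const).intervalIntegrable _ _
    have hsum := intervalIntegral.integral_add (hi 1) (hi Complex.I)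
    rw [hII s, add_zero] at hsum
    rw [← hsum]
    refine intervalIntegral.integral_nonneg (by positivity) fun θ _ => ?_
    rw [← laplacian_eq_fderiv]
    exact hkΔ _
  have hconv : ConvexOn ℝ Set.univ B := by
    have hd : deriv B = fun s : ℝ => ∫ θ in (0 : ℝ)..2 * Real.pi,
        fderiv ℝ k (s + θ * Complex.I) 1 := funext fun s => (hB1 s).deriv
    refine convexOn_univ_of_deriv2_nonneg (fun s => (hB1 s).differentiableAt) ?_ ?_
    · rw [hd]; exact fun s => (hB2 s).differentiableAt
    · intro s
      simp only [Function.iterate_succ, Function.iterate_zero, Function.comp_apply, id]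
      rw [hd, (hB2 s).deriv]
      exact hpos s
  have hBavg : ∀ s : ℝ, B s = (2 * Real.pi) * Real.circleAverage g 0 (Real.exp s) := fun s => by
    rw [Real.circleAverage_def, smul_eq_mul, ← mul_assoc, mul_inv_cancel₀ (by positivity), one_mul]
    refine intervalIntegral.integral_congr fun θ _ => ?_
    simp [hk, circleMap, Complex.exp_add]
  have hcA : Continuous fun r : ℝ => Real.circleAverage g 0 r := Real.Continuous.circleAverage hg.continuous
  have hlim : Filter.Tendsto B Filter.atBot (𝓝 (2 * Real.pi * g 0)) := by
    have h1 := (hcA.tendsto 0).comp Real.tendsto_exp_atBot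
    have h2 := h1.const_mul (2 * Real.pi)
    simp only [Real.circleAverage_zero] at h2
    exact h2.congr fun s => (hBavg s).symm
  have := le_of_convexOn_of_tendsto_atBot hconv hlim 0
  rw [hBavg, Real.exp_zero] at this
  exact le_of_mul_le_mul_left this (by positivity)

/-! ### The two charts of the Riemann sphere. -/

section Charts

theorem chartW_zero : chartW 0 = OnePoint.infty := by simp [chartW]

theorem chartW_of_ne {w : ℂ} (hw : w ≠ 0) : chartW w = chartZ w⁻¹ := by simp [chartW, chartZ, hw]

theorem continuous_chartZ : Continuous chartZ := OnePoint.continuous_coe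

theorem continuous_chartW : Continuous chartW := by
  rw [continuous_iff_continuousAt]
  intro w
  rcases eq_or_ne w 0 with rfl | hw
  · rw [continuousAt_iff_punctured_nhds, chartW_zero]
    have h1 : Filter.Tendsto (fun w : ℂ => w⁻¹) (𝓝[≠] 0) (Filter.coclosedCompact ℂ) := by
      rw [Filter.coclosedCompact_eq_cocompact, ← Metric.cobounded_eq_cocompact]
      exact Filter.tendsto_inv₀_nhdsNE_zero
    refine (OnePoint.tendsto_coe_infty.comp h1).congr' ?_
    filter_upwards [self_mem_nhdsWithin] with z hz
    exact (chartW_of_ne hz).symm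
  · have h1 : ContinuousAt (fun w : ℂ => chartZ w⁻¹) w :=
      continuous_chartZ.continuousAt.comp (continuousAt_inv₀ hw)
    refine h1.congr ?_
    filter_upwards [isOpen_ne.mem_nhds hw] with z hz
    exact (chartW_of_ne hz).symm

/-- The inversion `z ↦ 1 / z` of the Riemann sphere. -/
noncomputable def inversion (x : P1) : P1 := OnePoint.elim x (chartZ 0) chartW

theorem inversion_coe (z : ℂ) : inversion (z : OnePoint ℂ) = chartW z := rfl

theorem inversion_infty : inversion OnePoint.infty = chartZ 0 := rfl

theorem inversion_inversion (x : P1) : inversion (inversion x) = x := by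
  induction x using OnePoint.rec with
  | infty => rw [inversion_infty, chartZ, inversion_coe, chartW_zero]
  | coe z =>
    rw [inversion_coe]
    rcases eq_or_ne z 0 with rfl | hz
    · rw [chartW_zero, inversion_infty, chartZ]
    · rw [chartW_of_ne hz, chartZ, inversion_coe, chartW_of_ne (inv_ne_zero hz), inv_inv, chartZ]

theorem continuous_inversion : Continuous inversion := by
  refine (OnePoint.continuous_iff _).2 ⟨?_, continuous_chartW⟩
  rw [inversion_infty]
  have h1 : Filter.Tendsto (fun w : ℂ => w⁻¹) (Filter.coclosedCompact ℂ) (𝓝 0) := by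
    rw [Filter.coclosedCompact_eq_cocompact, ← Metric.cobounded_eq_cocompact]
    exact Filter.tendsto_inv₀_cobounded
  refine ((continuous_chartZ.tendsto 0).comp h1).congr' ?_
  have h2 : ∀ᶠ w : ℂ in Filter.coclosedCompact ℂ, w ≠ 0 := by
    rw [Filter.coclosedCompact_eq_cocompact]
    exact isCompact_singleton.compl_mem_cocompact
  filter_upwards [h2] with z hz
  rw [inversion_coe, chartW_of_ne hz]
  rfl

/-- The chart `chartW` is the inclusion of `ℂ` followed by the inversion, an involutive
homeomorphism. -/
theorem isOpenEmbedding_chart {c : ℂ → P1} (hc : c ∈ charts) : Topology.IsOpenEmbedding c := by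
  rcases hc with rfl | rfl
  · exact OnePoint.isOpenEmbedding_coe
  · let e : P1 ≃ₜ P1 :=
      { toFun := inversion
        invFun := inversion
        left_inv := inversion_inversion
        right_inv := inversion_inversion
        continuous_toFun := continuous_inversion
        continuous_invFun := continuous_inversion }
    exact e.isOpenEmbedding.comp OnePoint.isOpenEmbedding_coe

theorem exists_chart_eq (x : P1) : ∃ c ∈ charts, ∃ ζ : ℂ, c ζ = x := by
  induction x using OnePoint.rec with
  | infty => exact ⟨chartW, by simp [charts], 0, chartW_zero⟩
  | coe z => exact ⟨chartZ, by simp [charts], z, rfl⟩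

theorem continuous_of_charts {X : Type*} [TopologicalSpace X] {f : P1 → X}
    (h : ∀ c ∈ charts, Continuous (f ∘ c)) : Continuous f := by
  rw [continuous_iff_continuousAt]
  intro x
  obtain ⟨c, hc, ζ, rfl⟩ := exists_chart_eq x
  exact (isOpenEmbedding_chart hc).continuousAt_iff.1 (h c hc).continuousAt

theorem nhds_chart_prod {c : ℂ → P1} (hc : c ∈ charts) (q : ℂ × ℂ) :
    𝓝 (c q.1, q.2) = Filter.map (fun p : ℂ × ℂ => (c p.1, p.2)) (𝓝 q) :=
  (((isOpenEmbedding_chart hc).prodMap Topology.IsOpenEmbedding.id).map_nhds_eq q).symm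

end Charts

theorem coe_add_le_coe_iff {r g : ℝ} {x : EReal} :
    (r : EReal) + x ≤ (g : EReal) ↔ x ≤ ((g - r : ℝ) : EReal) := by
  induction x using EReal.rec with
  | bot => simp
  | top =>
    rw [EReal.coe_add_top, top_le_iff, top_le_iff]
    exact iff_of_false (EReal.coe_ne_top _) (EReal.coe_ne_top _)
  | coe x =>
    rw [← EReal.coe_add, EReal.coe_le_coe_iff, EReal.coe_le_coe_iff]
    constructor <;> intro <;> linarith

theorem _root_.UpperSemicontinuousOn.coe_add {X : Type*} [TopologicalSpace X] {s : Set X}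
    {f : X → EReal} {r : X → ℝ} (hf : UpperSemicontinuousOn f s) (hr : ContinuousOn r s) :
    UpperSemicontinuousOn (fun x => (r x : EReal) + f x) s := by
  refine UpperSemicontinuousOn.add' ?_ hf fun x _ => EReal.continuousAt_add (by simp) (by simp)
  exact (continuous_coe_real_ereal.comp_continuousOn hr).upperSemicontinuousOn

/-! ### Maximum principle and operations on plurisubharmonic functions. -/

section MaximumPrinciple

variable {E : Type*} [NormedAddCommGroup E] [NormedSpace ℂ E]

/-- A maximum principle: a plurisubharmonic function lies below `q` on a compact set if, at each
point where this is not known, `q` violates the sub-mean value inequality on some disc. -/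
theorem IsPlurisubharmonicOn.le_of_circleAverage_lt {v : E → EReal} {U K : Set E} {q : E → ℝ}
    (hv : IsPlurisubharmonicOn v U) (hK : IsCompact K) (husc : UpperSemicontinuousOn v K)
    (htop : ∀ p ∈ K, v p ≠ ⊤) (hq : ContinuousOn q K)
    (h : ∀ p ∈ K, v p ≤ (q p : EReal) ∨ ∃ b : E, (∀ ζ : ℂ, ‖ζ‖ ≤ 1 → p + ζ • b ∈ U ∩ K) ∧
      Real.circleAverage (fun ζ => q (p + ζ • b)) 0 1 < q p) :
    ∀ p ∈ K, v p ≤ (q p : EReal) := by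
  intro p hp
  by_contra! hlt
  -- At a maximum point `p₀` of `v - q`, a translate of `q` by a constant lies above `v` on `K` and
  -- touches it at `p₀`. The sub-mean value property of `v` then passes to `q` at `p₀`,
  -- contradicting the assumed strict inequality.
  obtain ⟨p₀, hp₀, hmax⟩ := (husc.coe_add hq.neg).exists_isMaxOn ⟨p, hp⟩ hK
  have hle : ∀ x ∈ K, ((-q x : ℝ) : EReal) + v x ≤ ((-q p₀ : ℝ) : EReal) + v p₀ :=
    fun x hx => hmax hx
  obtain ⟨s, hs⟩ : ∃ s : ℝ, v p = s := by
    have h1 : v p ≠ ⊥ := (lt_of_le_of_lt bot_le hlt).ne'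
    exact ⟨(v p).toReal, (EReal.coe_toReal (htop p hp) h1).symm⟩
  have hp₀bot : v p₀ ≠ ⊥ := by
    intro hbot
    have := hle p hp
    rw [hs, hbot, ← EReal.coe_add, EReal.add_bot] at this
    simp at this
  obtain ⟨m, hm⟩ : ∃ m : ℝ, v p₀ = m := ⟨_, (EReal.coe_toReal (htop p₀ hp₀) hp₀bot).symm⟩
  rw [hs, EReal.coe_lt_coe_iff] at hlt
  have h0 : -q p + s ≤ -q p₀ + m := by
    have := hle p hp
    rw [hs, hm] at this
    exact_mod_cast this
  rcases h p₀ hp₀ with h1 | ⟨b, hb, havg⟩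
  · rw [hm, EReal.coe_le_coe_iff] at h1
    linarith
  · have hcont : ContinuousOn (fun ζ : ℂ => q (p₀ + ζ • b)) (Metric.sphere 0 1) := by
      refine hq.comp (by fun_prop) fun ζ hζ => (hb ζ ?_).2
      simpa using (mem_sphere_zero_iff_norm.1 hζ).le
    have h2 := hv.2.2 p₀ b (fun ζ hζ => (hb ζ hζ).1)
      (fun ζ => (m - q p₀) + q (p₀ + ζ • b)) (continuousOn_const.add hcont) ?_
    · rw [Real.circleAverage_fun_add (circleIntegrable_const _ _ _)
        (ContinuousOn.circleIntegrable zero_le_one hcont), Real.circleAverage_const, hm,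
        EReal.coe_le_coe_iff] at h2
      linarith
    · intro ζ hζ
      have h3 := hle _ (hb ζ (mem_sphere_zero_iff_norm.1 hζ).le).2
      rw [hm, ← EReal.coe_add, coe_add_le_coe_iff] at h3
      refine h3.trans (EReal.coe_le_coe_iff.2 (by linarith))

/-- Restriction of a plurisubharmonic function along a complex affine map. -/
theorem IsPlurisubharmonicOn.comp_affine {F : Type*} [NormedAddCommGroup F] [NormedSpace ℂ F]
    {u : E → EReal} {U : Set E} (hu : IsPlurisubharmonicOn u U) (e : E) (A : F →L[ℂ] E) :
    IsPlurisubharmonicOn (fun x => u (e + A x)) ((fun x => e + A x) ⁻¹' U) := by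
  have hcont : Continuous fun x => e + A x := by fun_prop
  refine ⟨fun x hx y hy => ?_, fun p hp => hu.2.1 _ hp, fun a b hab g hg hle => ?_⟩
  · have ht : Filter.Tendsto (fun x => e + A x) (𝓝[(fun x => e + A x) ⁻¹' U] x)
        (𝓝[U] (e + A x)) :=
      hcont.continuousWithinAt.tendsto_nhdsWithin fun z hz => hz
    exact ht.eventually (hu.1 _ hx y hy)
  · have hkey : ∀ ζ : ℂ, e + A (a + ζ • b) = e + A a + ζ • A b := fun ζ => by
      simp [add_assoc]
    refine hu.2.2 (e + A a) (A b) (fun ζ hζ => ?_) g hg fun ζ hζ => ?_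
    · have := hab ζ hζ
      rwa [Set.mem_preimage, hkey] at this
    · have : u (e + A (a + ζ • b)) ≤ (g ζ : EReal) := hle ζ hζ
      rwa [hkey] at this

theorem isPlurisubharmonicOn_of_continuousOn {u : E → ℝ} {U : Set E} (hu : ContinuousOn u U)
    (h : ∀ a b : E, (∀ ζ : ℂ, ‖ζ‖ ≤ 1 → a + ζ • b ∈ U) →
      u a ≤ Real.circleAverage (fun ζ => u (a + ζ • b)) 0 1) :
    IsPlurisubharmonicOn (fun x => (u x : EReal)) U := by
  refine ⟨(continuous_coe_real_ereal.comp_continuousOn hu).upperSemicontinuousOn, by simp,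
    fun a b hab g hg hle => EReal.coe_le_coe_iff.2 ((h a b hab).trans ?_)⟩
  refine Real.circleAverage_mono (ContinuousOn.circleIntegrable zero_le_one ?_)
    (ContinuousOn.circleIntegrable zero_le_one hg) fun ζ hζ => ?_
  · refine hu.comp (by fun_prop) fun ζ hζ => hab ζ (mem_sphere_zero_iff_norm.1 hζ).le
  · rw [abs_one] at hζ
    exact EReal.coe_le_coe_iff.1 (hle ζ hζ)

theorem circleAverage_re_eq {k : ℂ → ℂ} (hk : Differentiable ℂ k) :
    Real.circleAverage (fun ζ => (k ζ).re) 0 1 = (k 0).re :=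
  InnerProductSpace.HarmonicOnNhd.circleAverage_eq fun z _ => (hk.analyticAt z).harmonicAt_re

theorem norm_add_sq_eq_re (p b : ℂ) :
    ‖p + b‖ ^ 2 = ((‖p‖ ^ 2 + ‖b‖ ^ 2 : ℝ) + 2 * (starRingEnd ℂ) p * b : ℂ).re := by
  simp only [← Complex.normSq_eq_norm_sq, Complex.normSq_apply]
  simp
  ring

/-- On the unit circle `|ζ b|² = |b|²`, so the integrand agrees there with the real part of a
function holomorphic in `ζ`, whose mean is its value at `0`. -/
theorem circleAverage_norm_add_sq (p b : ℂ) :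
    Real.circleAverage (fun ζ : ℂ => ‖p + ζ * b‖ ^ 2) 0 1 = ‖p‖ ^ 2 + ‖b‖ ^ 2 := by
  have h : Set.EqOn (fun ζ : ℂ => ‖p + ζ * b‖ ^ 2)
      (fun ζ => ((‖p‖ ^ 2 + ‖b‖ ^ 2 : ℝ) + 2 * (starRingEnd ℂ) p * (ζ * b) : ℂ).re)
      (Metric.sphere 0 |1|) := by
    intro ζ hζ
    have h1 : ‖ζ‖ = 1 := by simpa using hζ
    simp only [norm_add_sq_eq_re, norm_mul, h1, one_mul]
  rw [Real.circleAverage_congr_sphere h, circleAverage_re_eq (by fun_prop)]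
  simp only [zero_mul, mul_zero, add_zero, Complex.ofReal_re]

end MaximumPrinciple

/-! ### Candidates and boundary barriers. -/

theorem continuous_fsPotential : Continuous fsPotential := by
  unfold fsPotential
  refine Continuous.log (by fun_prop) fun z => by positivity

theorem chart_mem_closedProduct (c : ℂ → P1) {q : ℂ × ℂ}
    (hq : q ∈ (Set.univ : Set ℂ) ×ˢ Metric.ball (0 : ℂ) 1) : (c q.1, q.2) ∈ closedProduct :=
  ⟨Set.mem_univ _, Metric.ball_subset_closedBall hq.2⟩

theorem nhdsWithin_closedProduct_of_mem_ball {x : P1} {τ : ℂ} (hτ : τ ∈ Metric.ball (0 : ℂ) 1) :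
    𝓝[closedProduct] (x, τ) = 𝓝 (x, τ) := by
  refine nhdsWithin_eq_nhds.2 ?_
  rw [nhds_prod_eq]
  exact Filter.prod_mem_prod Filter.univ_mem
    (Filter.mem_of_superset (Metric.isOpen_ball.mem_nhds hτ) Metric.ball_subset_closedBall)

theorem upperSemicontinuousOn_chart {ψ : P1 × ℂ → EReal}
    (hψ : UpperSemicontinuousOn ψ closedProduct) {c : ℂ → P1} (hc : c ∈ charts) :
    UpperSemicontinuousOn (fun q : ℂ × ℂ => (fsPotential q.1 : EReal) + ψ (c q.1, q.2))
      (Set.univ ×ˢ Metric.closedBall 0 1) := by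
  refine UpperSemicontinuousOn.coe_add (fun q hq y hy => ?_)
    (continuous_fsPotential.comp continuous_fst).continuousOn
  have hcont : Continuous fun q : ℂ × ℂ => (c q.1, q.2) :=
    ((isOpenEmbedding_chart hc).continuous.comp continuous_fst).prodMk continuous_snd
  exact (hcont.continuousWithinAt.tendsto_nhdsWithin (s := Set.univ ×ˢ Metric.closedBall 0 1)
    (t := closedProduct) fun z hz => ⟨Set.mem_univ _, hz.2⟩).eventually (hψ _ ⟨Set.mem_univ _, hq.2⟩ y hy)

theorem IsCandidate.congr {φ : Circle → P1 → ℝ} {ψ₁ ψ₂ : P1 × ℂ → EReal} (h : IsCandidate φ ψ₁)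
    (heq : Set.EqOn ψ₁ ψ₂ closedProduct) : IsCandidate φ ψ₂ := by
  have hchart : ∀ c : ℂ → P1, Set.EqOn
      (fun q : ℂ × ℂ => (fsPotential q.1 : EReal) + ψ₁ (c q.1, q.2))
      (fun q : ℂ × ℂ => (fsPotential q.1 : EReal) + ψ₂ (c q.1, q.2))
      (Set.univ ×ˢ Metric.ball 0 1) := fun c q hq => by
    simp only [heq (chart_mem_closedProduct c hq)]
  refine ⟨?_, fun p hp => heq hp ▸ h.ne_top p hp, fun c hc => ?_, fun τ x => ?_⟩
  · intro p hp y hy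
    rw [← heq hp] at hy
    filter_upwards [h.usc p hp y hy, self_mem_nhdsWithin] with z hz hz'
    rwa [← heq hz']
  · obtain ⟨h1, h2, h3⟩ := h.psh c hc
    refine ⟨?_, fun p hp => hchart c hp ▸ h2 p hp, fun a b hab g hg hle => ?_⟩
    · intro p hp y hy
      rw [← hchart c hp] at hy
      filter_upwards [h1 p hp y hy, self_mem_nhdsWithin] with z hz hz'
      exact lt_of_eq_of_lt (hchart c hz').symm hz
    · rw [← hchart c (by simpa using hab 0 (by simp))]
      refine h3 a b hab g hg fun ζ hζ => ?_
      rw [hchart c (hab ζ (mem_sphere_zero_iff_norm.1 hζ).le)]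
      exact hle ζ hζ
  · rw [← heq ⟨Set.mem_univ _, by simp [Circle.norm_coe]⟩]
    exact h.boundary_le τ x

/-- Candidates of the form `f x + Re (k τ)` with `f` smooth and `k` entire. -/
theorem isCandidate_of_contDiff {φ : Circle → P1 → ℝ} {f : P1 → ℝ} {k : ℂ → ℂ}
    (hf : ∀ c ∈ charts, ContDiff ℝ 2 (fun ζ : ℂ => f (c ζ)) ∧
      ∀ ζ : ℂ, 0 ≤ Laplacian.laplacian (fun ξ : ℂ => fsPotential ξ + f (c ξ)) ζ)
    (hk : Differentiable ℂ k) (hle : ∀ (τ : Circle) (x : P1), f x + (k τ).re ≤ φ τ x) :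
    IsCandidate φ (fun p => ((f p.1 + (k p.2).re : ℝ) : EReal)) := by
  have hfc : Continuous f := continuous_of_charts fun c hc => (hf c hc).1.continuous
  have hcont : Continuous fun p : P1 × ℂ => f p.1 + (k p.2).re :=
    (hfc.comp continuous_fst).add
      (Complex.continuous_re.comp (hk.continuous.comp continuous_snd))
  refine ⟨(continuous_coe_real_ereal.comp hcont).upperSemicontinuous.upperSemicontinuousOn _,
    fun p _ => EReal.coe_ne_top _, fun c hc => ?_, fun τ x => EReal.coe_le_coe_iff.2 (hle τ x)⟩
  have hcc := (isOpenEmbedding_chart hc).continuous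
  set g : ℂ → ℝ := fun ξ => fsPotential ξ + f (c ξ) with hg
  have hgC : ContDiff ℝ 2 g := by
    refine ContDiff.add ?_ (hf c hc).1
    unfold fsPotential
    exact ((contDiff_const.add (contDiff_norm_sq ℝ))).log fun z => by positivity
  have hu : (fun q : ℂ × ℂ => (fsPotential q.1 : EReal)
      + ((f (c q.1, q.2).1 + (k (c q.1, q.2).2).re : ℝ) : EReal))
      = fun q : ℂ × ℂ => ((g q.1 + (k q.2).re : ℝ) : EReal) := by
    funext q
    rw [← EReal.coe_add, hg]
    congr 1
    ring
  rw [hu]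
  have hkc : Continuous fun ζ => (k ζ).re := Complex.continuous_re.comp hk.continuous
  refine isPlurisubharmonicOn_of_continuousOn
    (u := fun q : ℂ × ℂ => g q.1 + (k q.2).re) (Continuous.continuousOn ?_) fun a b _ => ?_
  · exact (hgC.continuous.comp continuous_fst).add (hkc.comp continuous_snd)
  · have hline : ∀ a b z : ℂ, AnalyticAt ℂ (fun ζ : ℂ => a + ζ * b) z := fun a b z =>
      (show Differentiable ℂ fun ζ : ℂ => a + ζ * b by fun_prop).analyticAt z
    have hlR : ContDiff ℝ 2 (fun ζ : ℂ => a.1 + ζ * b.1) := by fun_prop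
    have h1 : g a.1 ≤ Real.circleAverage (fun ζ : ℂ => g (a.1 + ζ * b.1)) 0 1 := by
      have := le_circleAverage_of_laplacian_nonneg (g := g ∘ fun ζ : ℂ => a.1 + ζ * b.1)
        (hgC.comp hlR) fun z => by
          rw [laplacian_comp_analytic (hline a.1 b.1 z) hgC.contDiffAt]
          exact mul_nonneg (sq_nonneg _) ((hf c hc).2 _)
      simpa [Function.comp_def] using this
    have h2 : Real.circleAverage (fun ζ : ℂ => (k (a.2 + ζ * b.2)).re) 0 1 = (k a.2).re := by
      rw [circleAverage_re_eq (k := fun ζ => k (a.2 + ζ * b.2)) (by fun_prop)]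
      simp
    simp only [Prod.fst_add, Prod.smul_fst, Prod.snd_add, Prod.smul_snd, smul_eq_mul]
    rw [Real.circleAverage_fun_add, h2]
    · linarith
    · exact ContinuousOn.circleIntegrable zero_le_one
        (hgC.continuous.comp (by fun_prop)).continuousOn
    · exact ContinuousOn.circleIntegrable zero_le_one (hkc.comp (by fun_prop)).continuousOn

/-- A pluriharmonic function on the disc, nonnegative there and vanishing at `σ`. -/
noncomputable def peak (σ : Circle) (τ : ℂ) : ℝ := 1 - (τ * (starRingEnd ℂ) (σ : ℂ)).re

theorem peak_self (σ : Circle) : peak σ σ = 0 := by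
  rw [peak, Complex.mul_conj, Complex.normSq_eq_norm_sq, Circle.norm_coe]
  simp

/-- On the circle the squared distance to `σ` is the restriction of a harmonic function; this lets a
modulus of continuity be replaced by a harmonic bound. -/
theorem peak_coe (σ τ : Circle) : 2 * peak σ τ = ‖(τ : ℂ) - σ‖ ^ 2 := by
  rw [sub_eq_add_neg, norm_add_sq_eq_re, norm_neg, Circle.norm_coe, Circle.norm_coe]
  simp [peak]
  ring

theorem continuous_peak (σ : Circle) : Continuous (peak σ) := by
  unfold peak
  fun_prop

theorem circleAverage_peak (σ : Circle) (a b : ℂ) :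
    Real.circleAverage (fun ζ => peak σ (a + ζ * b)) 0 1 = peak σ a := by
  have := circleAverage_re_eq
    (k := fun ζ => 1 - (a + ζ * b) * (starRingEnd ℂ) (σ : ℂ)) (by fun_prop)
  simpa [peak] using this

/-- With `d = L|τ - σ|`, the inequality `d ≤ ε + d²/(4ε)` together with `peak_coe` bounds the
oscillation by a function harmonic in `τ`, uniformly in `σ` and `x`. -/
theorem exists_oscillation_bound {φ : Circle → P1 → ℝ} {L : ℝ}
    (hL : ∀ τ σ x, |φ τ x - φ σ x| ≤ L * ‖(τ : ℂ) - σ‖) {ε : ℝ} (hε : 0 < ε) :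
    ∃ C : ℝ, ∀ (τ σ : Circle) (x : P1), |φ τ x - φ σ x| ≤ ε + C * peak σ τ := by
  refine ⟨L ^ 2 / (2 * ε), fun τ σ x => (hL τ σ x).trans ?_⟩
  have h : L ^ 2 / (2 * ε) * peak σ τ = (L * ‖(τ : ℂ) - σ‖) ^ 2 / (4 * ε) := by
    rw [mul_pow, ← peak_coe]
    field_simp
    ring
  rw [h]
  set d := L * ‖(τ : ℂ) - σ‖
  have h2 : ε + d ^ 2 / (4 * ε) - d = (d - 2 * ε) ^ 2 / (4 * ε) := by
    field_simp
    ring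
  have h3 : 0 ≤ (d - 2 * ε) ^ 2 / (4 * ε) := by positivity
  linarith

/-- The upper barrier: candidates are dominated by fibrewise harmonic majorants. -/
theorem IsCandidate.le_barrier {φ : Circle → P1 → ℝ} {ψ : P1 × ℂ → EReal} (hψ : IsCandidate φ ψ)
    {σ : Circle} {x : P1} {A C : ℝ} (h : ∀ τ : Circle, φ τ x ≤ A + C * peak σ τ) {τ : ℂ}
    (hτ : τ ∈ Metric.closedBall (0 : ℂ) 1) : ψ (x, τ) ≤ ((A + C * peak σ τ : ℝ) : EReal) := by
  obtain ⟨c, hc, w, rfl⟩ := exists_chart_eq x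
  set K : Set ℂ := Metric.closedBall 0 1
  have hpsh := (hψ.psh c hc).comp_affine ((w, 0) : ℂ × ℂ) (ContinuousLinearMap.inr ℂ ℂ ℂ)
  simp only [ContinuousLinearMap.inr_apply, Prod.mk_add_mk, add_zero, zero_add] at hpsh
  have husc : UpperSemicontinuousOn
      (fun τ : ℂ => (fsPotential w : EReal) + ψ (c w, τ)) K := by
    refine UpperSemicontinuousOn.coe_add (fun t ht y hy => ?_) continuousOn_const
    have hcont : Continuous fun t : ℂ => (c w, t) := by fun_prop
    exact (hcont.continuousWithinAt.tendsto_nhdsWithin (s := K) (t := closedProduct)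
      fun z hz => ⟨Set.mem_univ _, hz⟩).eventually (hψ.usc _ ⟨Set.mem_univ _, ht⟩ y hy)
  have htop : ∀ t ∈ K, (fsPotential w : EReal) + ψ (c w, t) ≠ ⊤ := fun t ht => by
    have := hψ.ne_top (c w, t) ⟨Set.mem_univ _, ht⟩
    exact EReal.add_ne_top (EReal.coe_ne_top _) this
  -- The term `η(1 - |τ|²)` vanishes on the circle and makes the majorant strictly superharmonic, as
  -- the maximum principle requires; afterwards `η → 0`.
  have key : ∀ η > 0, ψ (c w, τ) ≤ ((A + C * peak σ τ + η * (1 - ‖τ‖ ^ 2) : ℝ) : EReal) := by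
    intro η hη
    have hpc := continuous_peak σ
    have := hpsh.le_of_circleAverage_lt (K := K)
      (q := fun t => fsPotential w + (A + C * peak σ t + η * (1 - ‖t‖ ^ 2)))
      (isCompact_closedBall 0 1) husc htop (by fun_prop) ?_ τ hτ
    · rw [coe_add_le_coe_iff] at this
      simpa using this
    · intro p hp
      rcases (mem_closedBall_zero_iff.1 hp).eq_or_lt with h1 | h1
      · left
        obtain ⟨t, rfl⟩ : ∃ t : Circle, (t : ℂ) = p :=
          ⟨⟨p, by simpa [Submonoid.unitSphere] using h1⟩, rfl⟩
        rw [coe_add_le_coe_iff]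
        refine (hψ.boundary_le t (c w)).trans (EReal.coe_le_coe_iff.2 ?_)
        have h3 := h t
        rw [h1]
        linarith
      · right
        refine ⟨((1 - ‖p‖) / 2 : ℝ), fun ζ hζ => ?_, ?_⟩
        · have h2 : ‖p + ζ • (((1 - ‖p‖) / 2 : ℝ) : ℂ)‖ < 1 := by
            refine (norm_add_le _ _).trans_lt ?_
            rw [norm_smul, Complex.norm_real, Real.norm_of_nonneg (by linarith)]
            nlinarith [norm_nonneg ζ]
          refine ⟨?_, mem_closedBall_zero_iff.2 h2.le⟩
          simpa using h2
        · set b : ℂ := (((1 - ‖p‖) / 2 : ℝ) : ℂ) with hb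
          have hb0 : 0 < ‖b‖ := by
            rw [hb, Complex.norm_real, Real.norm_of_nonneg (by linarith)]
            linarith
          have hi : ∀ {r : ℂ → ℝ}, Continuous r → CircleIntegrable r 0 1 := fun hr =>
            ContinuousOn.circleIntegrable zero_le_one hr.continuousOn
          have h3 := Real.circleAverage_fun_add (f₁ := fun _ => fsPotential w + A + η)
            (f₂ := fun ζ : ℂ => C • peak σ (p + ζ * b) + (-η) • ‖p + ζ * b‖ ^ 2)
            (hi continuous_const) (hi (by fun_prop))
          have h4 := Real.circleAverage_fun_add (f₁ := fun ζ : ℂ => C • peak σ (p + ζ * b))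
            (f₂ := fun ζ : ℂ => (-η) • ‖p + ζ * b‖ ^ 2) (hi (by fun_prop)) (hi (by fun_prop))
          have e : (fun ζ : ℂ => fsPotential w + (A + C * peak σ (p + ζ • b)
              + η * (1 - ‖p + ζ • b‖ ^ 2))) = fun ζ : ℂ => (fsPotential w + A + η)
                + (C • peak σ (p + ζ * b) + (-η) • ‖p + ζ * b‖ ^ 2) := by
            funext ζ
            simp only [smul_eq_mul]
            ring
          rw [e, h3, h4, Real.circleAverage_const, Real.circleAverage_fun_smul, Real.circleAverage_fun_smul,
            circleAverage_peak, circleAverage_norm_add_sq]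
          simp only [smul_eq_mul]
          nlinarith [mul_pos hη (pow_pos hb0 2)]
  refine le_of_forall_gt_imp_ge_of_dense fun y hy => ?_
  have hlim : Filter.Tendsto (fun η : ℝ => ((A + C * peak σ τ + η * (1 - ‖τ‖ ^ 2) : ℝ) : EReal))
      (𝓝[>] 0) (𝓝 ((A + C * peak σ τ : ℝ) : EReal)) := by
    refine (continuous_coe_real_ereal.tendsto _).comp (Filter.Tendsto.mono_left ?_ nhdsWithin_le_nhds)
    have : Continuous fun η : ℝ => A + C * peak σ τ + η * (1 - ‖τ‖ ^ 2) := by fun_prop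
    simpa using this.tendsto 0
  obtain ⟨η, h1, h2⟩ := ((hlim.eventually (gt_mem_nhds hy)).and self_mem_nhdsWithin).exists
  exact (key η h2).trans h1.le

/-! ### Perron's method: the envelope is the weak solution. -/

/-- The upper semicontinuous regularization on `P1 × closed disc`. -/
noncomputable def uscRegularization (u : P1 × ℂ → EReal) (p : P1 × ℂ) : EReal :=
  Filter.limsup u (𝓝[closedProduct] p)

theorem le_uscRegularization (u : P1 × ℂ → EReal) {p : P1 × ℂ} (hp : p ∈ closedProduct) :
    u p ≤ uscRegularization u p := by
  refine Filter.le_limsup_of_frequently_le ?_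
  refine Filter.Frequently.filter_mono ?_ (pure_le_nhdsWithin hp)
  simp

theorem uscRegularization_le {u : P1 × ℂ → EReal} {p : P1 × ℂ} {y : EReal}
    (h : ∀ᶠ q in 𝓝[closedProduct] p, u q ≤ y) : uscRegularization u p ≤ y :=
  Filter.limsup_le_of_le (h := h)

theorem uscRegularization_le_of_continuous {u : P1 × ℂ → EReal} {b : P1 × ℂ → ℝ} {p : P1 × ℂ}
    (hb : ContinuousWithinAt b closedProduct p) (h : ∀ᶠ q in 𝓝[closedProduct] p, u q ≤ (b q : EReal)) :
    uscRegularization u p ≤ (b p : EReal) := by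
  refine le_of_forall_gt_imp_ge_of_dense fun y hy => uscRegularization_le ?_
  have h1 := (continuous_coe_real_ereal.tendsto (b p)).comp hb
  filter_upwards [h, h1.eventually (gt_mem_nhds hy)] with q h2 h3 using h2.trans h3.le

theorem upperSemicontinuousOn_uscRegularization (u : P1 × ℂ → EReal) :
    UpperSemicontinuousOn (uscRegularization u) closedProduct := by
  intro p _ y hy
  obtain ⟨y', h1, h2⟩ := exists_between hy
  have h3 : ∀ᶠ q in 𝓝[closedProduct] p, u q < y' := Filter.eventually_lt_of_limsup_lt h1
  filter_upwards [eventually_eventually_nhdsWithin.2 h3] with q hq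
  exact (uscRegularization_le (hq.mono fun _ h => h.le)).trans_lt h2

theorem le_envelope {φ : Circle → P1 → ℝ} {ψ : P1 × ℂ → EReal} (hψ : IsCandidate φ ψ)
    (p : P1 × ℂ) : ψ p ≤ envelope φ p :=
  le_iSup₂ (f := fun (ψ : P1 × ℂ → EReal) (_ : IsCandidate φ ψ) => ψ p) ψ hψ

theorem envelope_le {φ : Circle → P1 → ℝ} {p : P1 × ℂ} {y : EReal}
    (h : ∀ ψ, IsCandidate φ ψ → ψ p ≤ y) : envelope φ p ≤ y :=
  iSup₂_le h

/-- A majorant `g` of the regularization on the circle around `a` gives, by upper semicontinuity and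
compactness, the majorant `g + ε` on all nearby translated circles. Each candidate then satisfies
the sub-mean value inequality at the nearby centres with this one bound, which survives the supremum
over candidates and the limsup at `a`. -/
theorem isPlurisubharmonicOn_uscRegularization_envelope {φ : Circle → P1 → ℝ}
    (htop : ∀ p ∈ closedProduct, uscRegularization (envelope φ) p ≠ ⊤) {c : ℂ → P1}
    (hc : c ∈ charts) : IsPlurisubharmonicOn
      (fun q : ℂ × ℂ => (fsPotential q.1 : EReal) + uscRegularization (envelope φ) (c q.1, q.2))
      (Set.univ ×ˢ Metric.ball 0 1) := by
  set U : Set (ℂ × ℂ) := Set.univ ×ˢ Metric.ball 0 1 with hU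
  have hUo : IsOpen U := isOpen_univ.prod Metric.isOpen_ball
  set u : ℂ × ℂ → EReal :=
    fun q => (fsPotential q.1 : EReal) + uscRegularization (envelope φ) (c q.1, q.2) with hu
  have husc : UpperSemicontinuousOn u U := fun p hp y hy =>
    ((upperSemicontinuousOn_chart (upperSemicontinuousOn_uscRegularization _) hc) p
      ⟨hp.1, Metric.ball_subset_closedBall hp.2⟩ y hy).filter_mono
      (nhdsWithin_mono _ (Set.prod_mono_right Metric.ball_subset_closedBall))
  refine ⟨husc, fun p hp => EReal.add_ne_top (EReal.coe_ne_top _)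
    (htop _ (chart_mem_closedProduct c hp)), fun a b hab g hg hle => ?_⟩
  have key : ∀ ε > 0, uscRegularization (envelope φ) (c a.1, a.2)
      ≤ ((Real.circleAverage g 0 1 + ε - fsPotential a.1 : ℝ) : EReal) := by
    intro ε hε
    have hline : Continuous fun z : (ℂ × ℂ) × ℂ => z.1 + z.2 • b := by fun_prop
    have hdisc : ∀ᶠ p in 𝓝 a, ∀ ζ ∈ Metric.closedBall (0 : ℂ) 1, p + ζ • b ∈ U :=
      (isCompact_closedBall 0 1).eventually_forall_of_forall_eventually fun ζ hζ =>
        hline.continuousAt.eventually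
          (hUo.mem_nhds (hab ζ (mem_closedBall_zero_iff.1 hζ)))
    have hcirc : ∀ᶠ p in 𝓝 a, ∀ ζ ∈ Metric.sphere (0 : ℂ) 1,
        ζ ∈ Metric.sphere (0 : ℂ) 1 → u (p + ζ • b) ≤ ((g ζ + ε : ℝ) : EReal) := by
      refine (isCompact_sphere 0 1).eventually_forall_of_forall_eventually fun ζ hζ => ?_
      have hm : a + ζ • b ∈ U := hab ζ (mem_sphere_zero_iff_norm.1 hζ).le
      have h1 : u (a + ζ • b) < ((g ζ + ε / 2 : ℝ) : EReal) :=
        (hle ζ hζ).trans_lt (EReal.coe_lt_coe_iff.2 (by linarith))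
      have h2 := husc _ hm _ h1
      rw [hUo.nhdsWithin_eq hm] at h2
      have h3 := (hline.tendsto (a, ζ)).eventually h2
      have h4 : ∀ᶠ ζ' in 𝓝 ζ, ζ' ∈ Metric.sphere (0 : ℂ) 1 → g ζ - ε / 2 < g ζ' :=
        eventually_nhdsWithin_iff.1 ((hg ζ hζ).eventually (lt_mem_nhds (by linarith)))
      have h5 : ∀ᶠ z : (ℂ × ℂ) × ℂ in 𝓝 (a, ζ), z.2 ∈ Metric.sphere (0 : ℂ) 1 →
          g ζ - ε / 2 < g z.2 := (continuous_snd.tendsto (a, ζ)).eventually h4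
      filter_upwards [h3, h5] with z h6 h7 h8
      exact h6.le.trans (EReal.coe_le_coe_iff.2 (by linarith [h7 h8]))
    have hb : ∀ᶠ p in 𝓝 a, envelope φ (c p.1, p.2)
        ≤ ((Real.circleAverage g 0 1 + ε - fsPotential p.1 : ℝ) : EReal) := by
      filter_upwards [hdisc, hcirc] with p h1 h2
      refine envelope_le fun ψ hψ => coe_add_le_coe_iff.1 ?_
      have h3 := (hψ.psh c hc).2.2 p b (fun ζ hζ => h1 ζ (mem_closedBall_zero_iff.2 hζ))
        (fun ζ => g ζ + ε) (hg.add continuousOn_const) fun ζ hζ => ?_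
      · rwa [Real.circleAverage_fun_add (ContinuousOn.circleIntegrable zero_le_one hg)
          (circleIntegrable_const _ _ _), Real.circleAverage_const] at h3
      · refine le_trans ?_ (h2 ζ hζ hζ)
        have hm := chart_mem_closedProduct c (h1 ζ (Metric.sphere_subset_closedBall hζ))
        exact add_le_add_right ((le_envelope hψ _).trans (le_uscRegularization _ hm)) _
    refine le_of_forall_gt_imp_ge_of_dense fun y hy => uscRegularization_le ?_
    have ha : a.2 ∈ Metric.ball (0 : ℂ) 1 := by
      have := (hab 0 (by simp)).2
      simpa using this
    rw [nhdsWithin_closedProduct_of_mem_ball ha, nhds_chart_prod hc, Filter.eventually_map]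
    have hcont : Continuous fun p : ℂ × ℂ =>
        ((Real.circleAverage g 0 1 + ε - fsPotential p.1 : ℝ) : EReal) := by
      have := continuous_fsPotential
      exact continuous_coe_real_ereal.comp (by fun_prop)
    filter_upwards [hb, (hcont.tendsto a).eventually (gt_mem_nhds hy)] with p h1 h2
    exact h1.trans h2.le
  refine le_of_forall_gt_imp_ge_of_dense fun y hy => ?_
  obtain ⟨r, h1, h2⟩ := EReal.lt_iff_exists_real_btwn.1 hy
  have h3 := key (r - Real.circleAverage g 0 1) (by
    have := EReal.coe_lt_coe_iff.1 h1
    linarith)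
  refine le_trans (coe_add_le_coe_iff.2 (h3.trans_eq ?_)) h2.le
  congr 1
  ring

/-- Existence of the weak solution for boundary data that are Lipschitz in the circle variable. -/
theorem exists_isWeakSolution {φ : Circle → P1 → ℝ} (hK : ∀ τ, IsKahlerPotential (φ τ)) {L : ℝ}
    (hL : ∀ τ σ x, |φ τ x - φ σ x| ≤ L * ‖(τ : ℂ) - σ‖) :
    ∃ Φ : P1 × ℂ → ℝ, IsWeakSolution φ Φ := by
  have hφc : ∀ σ, Continuous (φ σ) := fun σ =>
    continuous_of_charts fun c hc => (hK σ c hc).1.continuous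
  set E := envelope φ with hE
  set R := uscRegularization E with hR
  have hub : ∀ {ε C : ℝ}, (∀ (τ σ : Circle) (x : P1), |φ τ x - φ σ x| ≤ ε + C * peak σ τ) →
      ∀ σ : Circle, ∀ p ∈ closedProduct,
        R p ≤ ((φ σ p.1 + ε + C * peak σ p.2 : ℝ) : EReal) := by
    intro ε C h σ p hp
    have hc1 := hφc σ
    have hc2 := continuous_peak σ
    refine uscRegularization_le_of_continuous
      (b := fun p : P1 × ℂ => φ σ p.1 + ε + C * peak σ p.2)
      (Continuous.continuousWithinAt (by fun_prop)) ?_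
    filter_upwards [self_mem_nhdsWithin] with q hq
    refine envelope_le fun ψ hψ => hψ.le_barrier (σ := σ) (x := q.1) (fun τ => ?_) hq.2
    linarith [le_abs_self (φ τ q.1 - φ σ q.1), h τ σ q.1]
  have hcircle : ∀ (τ : Circle) (x : P1), (x, (τ : ℂ)) ∈ closedProduct := fun τ x =>
    ⟨Set.mem_univ _, by simp [Circle.norm_coe]⟩
  have htop : ∀ p ∈ closedProduct, R p ≠ ⊤ := fun p hp => by
    obtain ⟨C, hC⟩ := exists_oscillation_bound hL one_pos
    exact ((hub hC 1 p hp).trans_lt (EReal.coe_lt_top _)).ne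
  have hRc : IsCandidate φ R := by
    refine ⟨upperSemicontinuousOn_uscRegularization _, htop,
      fun c hc => isPlurisubharmonicOn_uscRegularization_envelope htop hc, fun τ x => ?_⟩
    refine EReal.le_of_forall_lt_iff_le.1 fun z hz => ?_
    have hz' := EReal.coe_lt_coe_iff.1 hz
    obtain ⟨C, hC⟩ := exists_oscillation_bound hL (sub_pos.2 hz')
    refine (hub hC τ _ (hcircle τ x)).trans_eq ?_
    simp [peak_self]
  -- The regularization is one of the functions over which the supremum is taken, so it cannot
  -- exceed the envelope.
  have hRE : Set.EqOn R E closedProduct := fun p hp =>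
    le_antisymm (le_envelope hRc p) (le_uscRegularization _ hp)
  have hlb : ∀ {ε C : ℝ}, (∀ (τ σ : Circle) (x : P1), |φ τ x - φ σ x| ≤ ε + C * peak σ τ) →
      ∀ σ : Circle, ∀ p, ((φ σ p.1 - ε - C * peak σ p.2 : ℝ) : EReal) ≤ E p := by
    intro ε C h σ p
    have hcand := isCandidate_of_contDiff (φ := φ) (f := φ σ)
      -- The real part of this entire function is `-ε - C · peak σ τ`, so the candidate is `φ σ`
      -- minus the oscillation bound: a lower barrier at `σ`.
      (k := fun τ => (-ε - C : ℝ) + C * (τ * (starRingEnd ℂ) (σ : ℂ)))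
      (fun c hc => ⟨(hK σ c hc).1.of_le (WithTop.coe_le_coe.2 le_top), fun ζ => ((hK σ c hc).2 ζ).le⟩)
      (by fun_prop) fun τ x => by
        have h1 := h τ σ x
        have h2 := neg_abs_le (φ τ x - φ σ x)
        simp only [peak, Complex.add_re, Complex.re_ofReal_mul, Complex.ofReal_re] at h1 ⊢
        linarith
    refine le_trans (EReal.coe_le_coe_iff.2 (le_of_eq ?_)) (le_envelope hcand p)
    simp only [peak, Complex.add_re, Complex.re_ofReal_mul, Complex.ofReal_re]
    ring
  have hbot : ∀ p, E p ≠ ⊥ := fun p => by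
    obtain ⟨C, hC⟩ := exists_oscillation_bound hL one_pos
    exact ((EReal.bot_lt_coe _).trans_le (hlb hC 1 p)).ne'
  have hcoe : ∀ p ∈ closedProduct, (((E p).toReal : ℝ) : EReal) = E p := fun p hp =>
    EReal.coe_toReal (hRE hp ▸ htop p hp) (hbot p)
  refine ⟨fun p => (E p).toReal, hcoe, hRc.congr fun p hp => ?_, fun τ x => ?_⟩
  · rw [hcoe p hp, hRE hp]
  · have h1 := hcoe _ (hcircle τ x)
    refine le_antisymm ?_ (le_of_forall_pos_le_add fun ε hε => ?_)
    · have h2 := hRc.boundary_le τ x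
      rw [hRE (hcircle τ x), ← h1] at h2
      exact EReal.coe_le_coe_iff.1 h2
    · obtain ⟨C, hC⟩ := exists_oscillation_bound hL hε
      have h2 := hlb hC τ (x, τ)
      rw [← h1, EReal.coe_le_coe_iff] at h2
      simp only [peak_self, mul_zero] at h2
      linarith

/-! ### Holomorphic discs attached to rotating segments: the upper bound. -/

theorem le_zero_of_forall_le_mul {x : EReal} {C : ℝ}
    (h : ∀ η : ℝ, 0 < η → x ≤ ((C * η : ℝ) : EReal)) : x ≤ 0 := by
  refine le_of_forall_gt_imp_ge_of_dense fun y hy => ?_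
  have hlim : Filter.Tendsto (fun η : ℝ => ((C * η : ℝ) : EReal)) (𝓝[>] 0) (𝓝 0) := by
    have hc : Continuous fun η : ℝ => C * η := by fun_prop
    have := ((continuous_coe_real_ereal.comp hc).tendsto 0).mono_left
      (nhdsWithin_le_nhds (s := Set.Ioi 0))
    simpa [Function.comp_def] using this
  obtain ⟨η, h1, h2⟩ := ((hlim.eventually (gt_mem_nhds hy)).and self_mem_nhdsWithin).exists
  exact (h η h2).trans h1.le

theorem circleAverage_norm_add_pow_mul_sq (p b : ℂ) {n : ℕ} (hn : n ≠ 0) :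
    Real.circleAverage (fun ζ : ℂ => ‖p + ζ ^ n * b‖ ^ 2) 0 1 = ‖p‖ ^ 2 + ‖b‖ ^ 2 := by
  have h : Set.EqOn (fun ζ : ℂ => ‖p + ζ ^ n * b‖ ^ 2)
      (fun ζ => ((‖p‖ ^ 2 + ‖b‖ ^ 2 : ℝ) + 2 * (starRingEnd ℂ) p * (ζ ^ n * b) : ℂ).re)
      (Metric.sphere 0 |1|) := by
    intro ζ hζ
    have h1 : ‖ζ‖ = 1 := by simpa using hζ
    simp only [norm_add_sq_eq_re, norm_mul, norm_pow, h1, one_mul, one_pow]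
  rw [Real.circleAverage_congr_sphere h, circleAverage_re_eq (by fun_prop), zero_pow hn]
  simp only [zero_mul, mul_zero, add_zero, Complex.ofReal_re]

/-- A plurisubharmonic function on `ℂ × 𝔻` that is nonpositive on the boundary of the graph of
`τ ↦ A + k τ²` is nonpositive on that graph. -/
theorem le_zero_on_quadratic_disc {v : ℂ × ℂ → EReal}
    (hv : IsPlurisubharmonicOn v (Set.univ ×ˢ Metric.ball 0 1))
    (husc : UpperSemicontinuousOn v (Set.univ ×ˢ Metric.closedBall 0 1))
    (htop : ∀ p ∈ (Set.univ : Set ℂ) ×ˢ Metric.closedBall (0 : ℂ) 1, v p ≠ ⊤) {A k : ℂ}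
    (hbd : ∀ τ : ℂ, ‖τ‖ = 1 → v (A + k * τ ^ 2, τ) ≤ 0) {τ : ℂ} (hτ : ‖τ‖ ≤ 1) :
    v (A + k * τ ^ 2, τ) ≤ 0 := by
  set d : ℂ × ℂ → ℂ := fun p => p.1 - (A + k * p.2 ^ 2) with hd
  have hdc : Continuous d := by fun_prop
  -- Plurisubharmonicity is tested here only on affine discs, so the curved graph `d = 0` is
  -- thickened to a compact tube, with `N‖d‖²` as a penalty for leaving the graph.
  set K : Set (ℂ × ℂ) := {p | ‖d p‖ ≤ 1 ∧ ‖p.2‖ ≤ 1} with hKdef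
  have hK : IsCompact K := by
    have h1 : IsCompact ((fun p : ℂ × ℂ => (A + k * p.2 ^ 2 + p.1, p.2)) ''
        (Metric.closedBall 0 1 ×ˢ Metric.closedBall 0 1)) :=
      ((isCompact_closedBall 0 1).prod (isCompact_closedBall 0 1)).image (by fun_prop)
    refine h1.of_isClosed_subset ?_ fun p hp => ⟨(d p, p.2), ?_, ?_⟩
    · exact (isClosed_le hdc.norm continuous_const).inter
        (isClosed_le continuous_snd.norm continuous_const)
    · exact ⟨mem_closedBall_zero_iff.2 hp.1, mem_closedBall_zero_iff.2 hp.2⟩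
    · simp [hd]
  have hKsub : K ⊆ Set.univ ×ˢ Metric.closedBall 0 1 := fun p hp =>
    ⟨Set.mem_univ _, mem_closedBall_zero_iff.2 hp.2⟩
  have huscK := husc.mono hKsub
  have hmem : ∀ t : ℂ, ‖t‖ ≤ 1 → (A + k * t ^ 2, t) ∈ K := fun t ht => by
    simp [hKdef, hd, ht]
  obtain ⟨M, hM0, hM⟩ : ∃ M : ℝ, 0 ≤ M ∧ ∀ p ∈ K, v p ≤ (M : EReal) := by
    obtain ⟨p₀, hp₀, hmax⟩ := huscK.exists_isMaxOn ⟨_, hmem τ hτ⟩ hK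
    refine ⟨max (v p₀).toReal 0, le_max_right _ _, fun p hp => ?_⟩
    exact ((hmax hp).trans (EReal.le_coe_toReal (htop _ (hKsub hp₀)))).trans
      (EReal.coe_le_coe_iff.2 (le_max_left _ _))
  refine le_zero_of_forall_le_mul (C := 2) fun η hη => ?_
  -- The boundary points of the tube with `v ≥ η` form a compact set that misses the graph, so they
  -- stay at a positive distance from it in terms of `‖d‖`.
  obtain ⟨δ, hδ0, hδ⟩ : ∃ δ > 0, ∀ p ∈ K, ‖p.2‖ = 1 → (η : EReal) ≤ v p → δ ≤ ‖d p‖ := by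
    set Z : Set (ℂ × ℂ) := (K ∩ {p | ‖p.2‖ = 1}) ∩ v ⁻¹' Set.Ici (η : EReal) with hZ
    have hZc : IsCompact Z :=
      (huscK.mono Set.inter_subset_left).isCompact_inter_preimage_Ici
        (hK.inter_right (isClosed_eq continuous_snd.norm continuous_const)) _
    rcases Z.eq_empty_or_nonempty with he | hne
    · refine ⟨1, one_pos, fun p hp h1 h2 => ?_⟩
      have : p ∈ Z := ⟨⟨hp, h1⟩, h2⟩
      simp [he] at this
    · obtain ⟨p₁, hp₁, hmin⟩ := hZc.exists_isMinOn hne hdc.norm.continuousOn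
      refine ⟨‖d p₁‖, norm_pos_iff.2 fun h0 => ?_, fun p hp h1 h2 => hmin ⟨⟨hp, h1⟩, h2⟩⟩
      have h1 := hbd p₁.2 hp₁.1.2
      rw [← sub_eq_zero.1 h0] at h1
      have h2 : (η : EReal) ≤ 0 := le_trans hp₁.2 h1
      rw [← EReal.coe_zero, EReal.coe_le_coe_iff] at h2
      linarith
  -- Large enough that `N‖d‖² ≥ M` both where `‖d‖ ≥ δ` and on the lateral boundary `‖d‖ = 1`.
  set N : ℝ := M / δ ^ 2 + M with hN
  have hN0 : 0 ≤ N := by positivity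
  have hpsh := hv.le_of_circleAverage_lt (K := K)
    (q := fun p => η + N * ‖d p‖ ^ 2 + η * (1 - ‖p.2‖ ^ 2)) hK huscK
    (fun p hp => htop p (hKsub hp)) (by fun_prop) ?_ _ (hmem τ hτ)
  · refine hpsh.trans (EReal.coe_le_coe_iff.2 ?_)
    simp only [hd, sub_self, norm_zero]
    nlinarith [sq_nonneg ‖τ‖]
  intro p hp
  rcases hp.2.eq_or_lt with h1 | h1
  · left
    rcases le_or_gt (η : EReal) (v p) with h2 | h2
    · refine (hM p hp).trans (EReal.coe_le_coe_iff.2 ?_)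
      have h3 : δ ^ 2 ≤ ‖d p‖ ^ 2 := by gcongr; exact hδ p hp h1 h2
      have h4 : M ≤ M / δ ^ 2 * ‖d p‖ ^ 2 := by
        rw [div_mul_eq_mul_div, le_div_iff₀ (by positivity)]
        gcongr
      rw [h1]
      nlinarith [mul_nonneg hM0 (sq_nonneg ‖d p‖)]
    · refine h2.le.trans (EReal.coe_le_coe_iff.2 ?_)
      rw [h1]
      nlinarith [mul_nonneg hN0 (sq_nonneg ‖d p‖)]
  rcases hp.1.eq_or_lt with h2 | h2
  · left
    refine (hM p hp).trans (EReal.coe_le_coe_iff.2 ?_)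
    rw [h2]
    have h3 : 0 ≤ M / δ ^ 2 := by positivity
    have h4 : ‖p.2‖ ^ 2 ≤ 1 := pow_le_one₀ (norm_nonneg _) h1.le
    nlinarith [mul_nonneg hη.le (sub_nonneg.2 h4)]
  right
  obtain ⟨r, ⟨hr1, hr2, hr3⟩, hr0⟩ : ∃ r : ℝ, (‖d p‖ + ‖k‖ * r ^ 2 < 1 ∧ ‖p.2‖ + r < 1 ∧
      N * ‖k‖ ^ 2 * r ^ 2 < η) ∧ 0 < r := by
    have e1 : ∀ᶠ r : ℝ in 𝓝 0, ‖d p‖ + ‖k‖ * r ^ 2 < 1 :=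
      ContinuousAt.eventually_lt (by fun_prop) continuousAt_const (by simpa using h2)
    have e2 : ∀ᶠ r : ℝ in 𝓝 0, ‖p.2‖ + r < 1 :=
      ContinuousAt.eventually_lt (by fun_prop) continuousAt_const (by simpa using h1)
    have e3 : ∀ᶠ r : ℝ in 𝓝 0, N * ‖k‖ ^ 2 * r ^ 2 < η :=
      ContinuousAt.eventually_lt (by fun_prop) continuousAt_const (by simpa using hη)
    exact (((e1.and (e2.and e3)).filter_mono (nhdsWithin_le_nhds (s := Set.Ioi 0))).and
      self_mem_nhdsWithin).exists
  -- The direction is tangent to the translate of the graph through `p`, so `d` varies only to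
  -- second order. Averaging raises `N‖d‖²` by `N|k|²r⁴` and lowers the term `-η‖τ‖²` by `ηr²`; the
  -- choice of `r` makes the net change negative.
  have hdline : ∀ ζ : ℂ, d (p + ζ • ((r * (2 * k * p.2) : ℂ), (r : ℂ)))
      = d p + ζ ^ 2 * (-k * r ^ 2) := fun ζ => by
    simp only [hd, Prod.fst_add, Prod.smul_fst, Prod.snd_add, Prod.smul_snd, smul_eq_mul]
    ring
  have hsnd : ∀ ζ : ℂ, (p + ζ • ((r * (2 * k * p.2) : ℂ), (r : ℂ))).2 = p.2 + ζ * r := fun ζ => by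
    simp
  have hnr : ‖(r : ℂ)‖ = r := by rw [Complex.norm_real, Real.norm_of_nonneg hr0.le]
  have hnk : ‖-k * (r : ℂ) ^ 2‖ = ‖k‖ * r ^ 2 := by rw [norm_mul, norm_neg, norm_pow, hnr]
  refine ⟨((r * (2 * k * p.2) : ℂ), (r : ℂ)), fun ζ hζ => ?_, ?_⟩
  · have h3 : ‖p.2 + ζ * r‖ < 1 := by
      refine (norm_add_le _ _).trans_lt ?_
      rw [norm_mul, hnr]
      nlinarith
    refine ⟨⟨Set.mem_univ _, ?_⟩, ?_, ?_⟩
    · rw [hsnd]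
      exact mem_ball_zero_iff.2 h3
    · rw [hdline]
      refine (norm_add_le _ _).trans ?_
      rw [norm_mul, hnk, norm_pow]
      have h5 : ‖ζ‖ ^ 2 ≤ 1 := pow_le_one₀ (norm_nonneg _) hζ
      nlinarith [mul_nonneg (norm_nonneg k) (sq_nonneg r)]
    · rw [hsnd]
      exact h3.le
  · have hi : ∀ {r : ℂ → ℝ}, Continuous r → CircleIntegrable r 0 1 := fun hr =>
      ContinuousOn.circleIntegrable zero_le_one hr.continuousOn
    have e : (fun ζ : ℂ => η + N * ‖d (p + ζ • ((r * (2 * k * p.2) : ℂ), (r : ℂ)))‖ ^ 2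
        + η * (1 - ‖(p + ζ • ((r * (2 * k * p.2) : ℂ), (r : ℂ))).2‖ ^ 2))
        = fun ζ : ℂ => 2 * η
          + (N • ‖d p + ζ ^ 2 * (-k * r ^ 2)‖ ^ 2 + (-η) • ‖p.2 + ζ * r‖ ^ 2) := by
      funext ζ
      rw [hdline, hsnd]
      simp only [smul_eq_mul]
      ring
    have e1 := Real.circleAverage_fun_add (f₁ := fun _ : ℂ => 2 * η)
      (f₂ := fun ζ : ℂ => N • ‖d p + ζ ^ 2 * (-k * r ^ 2)‖ ^ 2 + (-η) • ‖p.2 + ζ * r‖ ^ 2)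
      (hi continuous_const) (hi (by fun_prop))
    have e2 := Real.circleAverage_fun_add
      (f₁ := fun ζ : ℂ => N • ‖d p + ζ ^ 2 * (-k * r ^ 2)‖ ^ 2)
      (f₂ := fun ζ : ℂ => (-η) • ‖p.2 + ζ * r‖ ^ 2) (hi (by fun_prop)) (hi (by fun_prop))
    rw [e, e1, e2, Real.circleAverage_const, Real.circleAverage_fun_smul,
      Real.circleAverage_fun_smul, circleAverage_norm_add_pow_mul_sq _ _ two_ne_zero,
      circleAverage_norm_add_sq, hnr, hnk]
    simp only [smul_eq_mul]
    nlinarith [mul_lt_mul_of_pos_right hr3 (pow_pos hr0 2)]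

/-- A subharmonic function on `ℂ` that is nonpositive on the ellipse
`{e + β conj e | ‖e‖ = ρ}` is nonpositive inside. -/
theorem le_zero_in_ellipse {v : ℂ → EReal} (hv : IsPlurisubharmonicOn v Set.univ) {β : ℂ}
    (hβ : ‖β‖ < 1) {ρ : ℝ} (hρ : 0 ≤ ρ)
    (hbd : ∀ e : ℂ, ‖e‖ = ρ → v (e + β * (starRingEnd ℂ) e) ≤ 0) {w : ℂ}
    (hw : ‖w‖ ≤ ρ * (1 - ‖β‖)) : v w ≤ 0 := by
  -- Since `T(e + β ē) = (1 - |β|²) e`, the filled ellipse is the set `‖T z‖ ≤ s`, and its boundary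
  -- points are recovered from `e = T p / (1 - |β|²)`.
  set T : ℂ → ℂ := fun z => z - β * (starRingEnd ℂ) z with hT
  have hTc : Continuous T := by fun_prop
  set s : ℝ := ρ * (1 - ‖β‖ ^ 2) with hs
  have hβ2 : 0 < 1 - ‖β‖ ^ 2 := by nlinarith [norm_nonneg β]
  set K : Set ℂ := {z | ‖T z‖ ≤ s} with hKdef
  have hlow : ∀ z, ‖z‖ * (1 - ‖β‖) ≤ ‖T z‖ := fun z => by
    have := norm_sub_norm_le z (β * (starRingEnd ℂ) z)
    rw [norm_mul, RCLike.norm_conj] at this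
    linarith
  have hupp : ∀ z, ‖T z‖ ≤ ‖z‖ * (1 + ‖β‖) := fun z => by
    have := norm_sub_le z (β * (starRingEnd ℂ) z)
    rw [norm_mul, RCLike.norm_conj] at this
    linarith
  have hbound : ∀ z ∈ K, ‖z‖ ≤ 2 * ρ := fun z hz => by
    have h1 : ‖z‖ * (1 - ‖β‖) ≤ ρ * (1 + ‖β‖) * (1 - ‖β‖) := by
      refine (hlow z).trans (le_trans hz (le_of_eq ?_))
      rw [hs]
      ring
    have h2 := le_of_mul_le_mul_right h1 (by linarith)
    nlinarith
  have hK : IsCompact K := by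
    refine (isCompact_closedBall (0 : ℂ) (2 * ρ)).of_isClosed_subset
      (isClosed_le hTc.norm continuous_const) fun z hz => mem_closedBall_zero_iff.2 (hbound z hz)
  have hwK : w ∈ K := by
    refine (hupp w).trans ?_
    rw [hs]
    nlinarith [norm_nonneg β]
  refine le_zero_of_forall_le_mul (C := (2 * ρ) ^ 2) fun η hη => ?_
  have hmax := hv.le_of_circleAverage_lt (K := K) (q := fun z => η * ((2 * ρ) ^ 2 - ‖z‖ ^ 2)) hK
    (hv.1.mono (Set.subset_univ _)) (fun p _ => hv.2.1 p (Set.mem_univ _)) (by fun_prop) ?_ w hwK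
  · refine hmax.trans (EReal.coe_le_coe_iff.2 ?_)
    nlinarith [mul_nonneg hη.le (sq_nonneg ‖w‖)]
  intro p hp
  rcases (show ‖T p‖ ≤ s from hp).eq_or_lt with h1 | h1
  · left
    have h2 : v p ≤ 0 := by
      set e : ℂ := (((1 - ‖β‖ ^ 2)⁻¹ : ℝ) : ℂ) * T p with he
      have h3 : ‖e‖ = ρ := by
        rw [he, norm_mul, h1, Complex.norm_real, Real.norm_of_nonneg (by positivity), hs]
        field_simp
      have h4 : e + β * (starRingEnd ℂ) e = p := by
        have h5 : T p + β * (starRingEnd ℂ) (T p) = ((1 - ‖β‖ ^ 2 : ℝ) : ℂ) * p := by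
          have h6 := Complex.mul_conj β
          rw [Complex.normSq_eq_norm_sq] at h6
          simp only [hT, map_sub, map_mul, Complex.conj_conj]
          push_cast at h6 ⊢
          linear_combination (-p) * h6
        have h7 : (((1 - ‖β‖ ^ 2)⁻¹ : ℝ) : ℂ) * ((1 - ‖β‖ ^ 2 : ℝ) : ℂ) = 1 := by
          rw [← Complex.ofReal_mul, inv_mul_cancel₀ hβ2.ne', Complex.ofReal_one]
        rw [he, map_mul, Complex.conj_ofReal]
        linear_combination (((1 - ‖β‖ ^ 2)⁻¹ : ℝ) : ℂ) * h5 + p * h7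
      rw [← h4]
      exact hbd e h3
    refine h2.trans ?_
    rw [← EReal.coe_zero, EReal.coe_le_coe_iff]
    have h8 : ‖p‖ ^ 2 ≤ (2 * ρ) ^ 2 := by
      gcongr
      exact hbound p hp
    exact mul_nonneg hη.le (by linarith)
  · right
    obtain ⟨r, hr0, hr⟩ := Metric.isOpen_iff.1 (isOpen_lt hTc.norm continuous_const) p h1
    have hnr : ‖((r / 2 : ℝ) : ℂ)‖ = r / 2 := by
      rw [Complex.norm_real, Real.norm_of_nonneg (by positivity)]
    refine ⟨((r / 2 : ℝ) : ℂ), fun ζ hζ => ⟨Set.mem_univ _, ?_⟩, ?_⟩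
    · refine (show ‖T _‖ < s from hr ?_).le
      rw [Metric.mem_ball, dist_eq_norm, add_sub_cancel_left, norm_smul, hnr]
      nlinarith
    · have hi : ∀ {r : ℂ → ℝ}, Continuous r → CircleIntegrable r 0 1 := fun hr =>
        ContinuousOn.circleIntegrable zero_le_one hr.continuousOn
      have e : (fun ζ : ℂ => η * ((2 * ρ) ^ 2 - ‖p + ζ • ((r / 2 : ℝ) : ℂ)‖ ^ 2))
          = fun ζ : ℂ => η * (2 * ρ) ^ 2 + (-η) • ‖p + ζ * ((r / 2 : ℝ) : ℂ)‖ ^ 2 := by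
        funext ζ
        simp only [smul_eq_mul]
        ring
      rw [e, Real.circleAverage_fun_add (hi continuous_const) (hi (by fun_prop)),
        Real.circleAverage_const, Real.circleAverage_fun_smul, circleAverage_norm_add_sq, hnr,
        smul_eq_mul]
      nlinarith [mul_pos hη (pow_pos (half_pos hr0) 2)]

/-- If `v` is plurisubharmonic on `ℂ × 𝔻` and nonpositive on the rotating segments
`{τ t | -2ρ ≤ t ≤ 2ρ}`, `‖τ‖ = 1`, then it is nonpositive on an open subset of `ℂ × 𝔻`. -/
theorem le_zero_of_le_zero_on_rotating_segment {v : ℂ × ℂ → EReal}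
    (hv : IsPlurisubharmonicOn v (Set.univ ×ˢ Metric.ball 0 1))
    (husc : UpperSemicontinuousOn v (Set.univ ×ˢ Metric.closedBall 0 1))
    (htop : ∀ p ∈ (Set.univ : Set ℂ) ×ˢ Metric.closedBall (0 : ℂ) 1, v p ≠ ⊤) {ρ : ℝ}
    (hρ : 0 ≤ ρ) (hbd : ∀ (τ : ℂ) (t : ℝ), ‖τ‖ = 1 → |t| ≤ 2 * ρ → v (t * τ, τ) ≤ 0) {w τ : ℂ}
    (hτ : ‖τ‖ < 1) (hw : ‖w‖ ≤ ρ * (1 - ‖τ‖ ^ 2)) : v (w, τ) ≤ 0 := by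
  have hslice := hv.comp_affine ((0, τ) : ℂ × ℂ) (ContinuousLinearMap.inl ℂ ℂ ℂ)
  simp only [ContinuousLinearMap.inl_apply, Prod.mk_add_mk, add_zero, zero_add] at hslice
  have hpre : (fun x : ℂ => (x, τ)) ⁻¹' Set.univ ×ˢ Metric.ball 0 1 = Set.univ := by
    ext x
    simpa using hτ
  rw [hpre] at hslice
  -- The disc with coefficients `e` and `ē` passes over `τ` at `e + τ² ē`, which is the
  -- parametrization of the ellipse with `β = τ²`.
  refine le_zero_in_ellipse hslice (β := τ ^ 2) ?_ hρ (fun e he => ?_) (by rwa [norm_pow])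
  · rw [norm_pow]
    exact pow_lt_one₀ (norm_nonneg _) hτ two_ne_zero
  · have h := le_zero_on_quadratic_disc hv husc htop (A := e) (k := (starRingEnd ℂ) e)
      (fun t ht => ?_) hτ.le
    · rwa [mul_comm] at h
    · have h1 : e + (starRingEnd ℂ) e * t ^ 2 = ((2 * (e * (starRingEnd ℂ) t).re : ℝ) : ℂ) * t := by
        have h2 := Complex.mul_conj t
        rw [Complex.normSq_eq_norm_sq, ht] at h2
        have h3 := Complex.add_conj (e * (starRingEnd ℂ) t)
        rw [← h3, map_mul, Complex.conj_conj]
        push_cast at h2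
        linear_combination (-e) * h2
      rw [h1]
      refine hbd t _ ht ?_
      have h4 := Complex.abs_re_le_norm (e * (starRingEnd ℂ) t)
      rw [norm_mul, RCLike.norm_conj, ht, he, mul_one] at h4
      rw [abs_mul, abs_two]
      linarith

/-! ### Construction of the strictly subharmonic profile. -/

section LaplacianLog

theorem fderiv_fderiv_log_eq_of_line {g : ℂ → ℝ} {z v : ℂ} (hg : ContDiff ℝ 2 g)
    (hpos : ∀ w, 0 < g w) {g₁ : ℝ → ℝ} {c : ℝ}
    (h₁ : ∀ t : ℝ, HasDerivAt (fun s : ℝ => g (z + s • v)) (g₁ t) t) (h₂ : HasDerivAt g₁ c 0) :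
    fderiv ℝ (fderiv ℝ fun w => Real.log (g w)) z v v = (c * g z - g₁ 0 ^ 2) / g z ^ 2 := by
  refine fderiv_fderiv_eq_of_line (hg.log fun w => (hpos w).ne').contDiffAt
    (g₁ := fun t => g₁ t / g (z + t • v)) ?_ ?_
  · exact Filter.Eventually.of_forall fun t => (h₁ t).log (hpos _).ne'
  · have h := h₂.div (h₁ 0) (hpos _).ne'
    simp only [zero_smul, add_zero] at h
    rwa [sq (g₁ 0)]

theorem laplacian_log_eq {g : ℂ → ℝ} {z : ℂ} (hg : ContDiff ℝ 2 g) (hpos : ∀ w, 0 < g w)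
    {gx gy : ℝ → ℝ} {cx cy : ℝ}
    (hx : ∀ t : ℝ, HasDerivAt (fun s : ℝ => g (z + s • 1)) (gx t) t) (hxx : HasDerivAt gx cx 0)
    (hy : ∀ t : ℝ, HasDerivAt (fun s : ℝ => g (z + s • Complex.I)) (gy t) t)
    (hyy : HasDerivAt gy cy 0) :
    Laplacian.laplacian (fun w => Real.log (g w)) z
      = ((cx + cy) * g z - (gx 0 ^ 2 + gy 0 ^ 2)) / g z ^ 2 := by
  rw [laplacian_eq_fderiv, fderiv_fderiv_log_eq_of_line hg hpos hx hxx,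
    fderiv_fderiv_log_eq_of_line hg hpos hy hyy]
  ring

theorem norm_sq_eq_re_im (z : ℂ) : ‖z‖ ^ 2 = z.re ^ 2 + z.im ^ 2 := by
  rw [← Complex.normSq_eq_norm_sq, Complex.normSq_apply]
  ring

theorem hasDerivAt_add_sq (a t : ℝ) : HasDerivAt (fun s : ℝ => (a + s) ^ 2) (2 * (a + t)) t := by
  refine (((hasDerivAt_id t).const_add a).pow 2).congr_deriv ?_
  simp

theorem hasDerivAt_two_mul_add (a t : ℝ) : HasDerivAt (fun s : ℝ => 2 * (a + s)) 2 t := by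
  simpa using ((hasDerivAt_id t).const_add a).const_mul 2

theorem laplacian_log_add_norm_sq {δ : ℝ} (hδ : 0 < δ) (z : ℂ) :
    Laplacian.laplacian (fun w : ℂ => Real.log (δ + ‖w‖ ^ 2)) z = 4 * δ / (δ + ‖z‖ ^ 2) ^ 2 := by
  rw [laplacian_log_eq (g := fun w : ℂ => δ + ‖w‖ ^ 2) (z := z)
    (gx := fun t => 2 * (z.re + t)) (gy := fun t => 2 * (z.im + t)) (cx := 2) (cy := 2)
    (contDiff_const.add (contDiff_norm_sq ℝ)) (fun w => by positivity)
    (fun t => ?_) (hasDerivAt_two_mul_add _ _) (fun t => ?_) (hasDerivAt_two_mul_add _ _)]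
  · congr 1
    rw [norm_sq_eq_re_im]
    ring
  · simpa [norm_sq_eq_re_im] using
      ((hasDerivAt_add_sq z.re t).add_const (z.im ^ 2)).const_add δ
  · simpa [norm_sq_eq_re_im] using
      ((hasDerivAt_add_sq z.im t).const_add (z.re ^ 2)).const_add δ

end LaplacianLog

theorem exists_bound_deriv_smoothTransition :
    ∃ C : ℝ, 0 ≤ C ∧ (∀ x, |deriv Real.smoothTransition x| ≤ C) ∧
      ∀ x, |deriv (deriv Real.smoothTransition) x| ≤ C := by
  have hθ : ContDiff ℝ 2 Real.smoothTransition := Real.smoothTransition.contDiff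
  have hθ1 : ContDiff ℝ 1 (deriv Real.smoothTransition) := by
    have := (contDiff_succ_iff_deriv (n := 1)).1 (hθ.of_le (by norm_num))
    exact this.2.2
  have hc1 := hθ1.continuous
  have hc2 : Continuous (deriv (deriv Real.smoothTransition)) := hθ1.continuous_deriv le_rfl
  have hout : ∀ x ∉ Set.Icc (0 : ℝ) 1, deriv Real.smoothTransition =ᶠ[𝓝 x] fun _ => 0 := by
    intro x hx
    rw [Set.mem_Icc, not_and_or, not_le, not_le] at hx
    rcases hx with hx | hx
    · filter_upwards [gt_mem_nhds hx] with y hy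
      have : Real.smoothTransition =ᶠ[𝓝 y] fun _ => 0 := by
        filter_upwards [gt_mem_nhds hy] with z hz using Real.smoothTransition.zero_of_nonpos hz.le
      rw [this.deriv_eq, deriv_const]
    · filter_upwards [lt_mem_nhds hx] with y hy
      have : Real.smoothTransition =ᶠ[𝓝 y] fun _ => 1 := by
        filter_upwards [lt_mem_nhds hy] with z hz using Real.smoothTransition.one_of_one_le hz.le
      rw [this.deriv_eq, deriv_const]
  obtain ⟨C₁, h1⟩ := (isCompact_Icc (a := (0 : ℝ)) (b := 1)).exists_bound_of_continuousOn
    hc1.continuousOn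
  obtain ⟨C₂, h2⟩ := (isCompact_Icc (a := (0 : ℝ)) (b := 1)).exists_bound_of_continuousOn
    hc2.continuousOn
  refine ⟨max 0 (max C₁ C₂), le_max_left _ _, fun x => ?_, fun x => ?_⟩
  · by_cases hx : x ∈ Set.Icc (0 : ℝ) 1
    · exact (h1 x hx).trans ((le_max_left _ _).trans (le_max_right _ _))
    · rw [(hout x hx).eq_of_nhds, abs_zero]
      exact le_max_left _ _
  · by_cases hx : x ∈ Set.Icc (0 : ℝ) 1
    · exact (h2 x hx).trans ((le_max_right _ _).trans (le_max_right _ _))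
    · rw [(hout x hx).deriv_eq, deriv_const, abs_zero]
      exact le_max_left _ _

/-- Cutoffs on a logarithmic scale: `κ` goes from `0` near `0` to `1` before `1 / 2`, while the
scale-invariant quantities `s κ'(s)` and `s² κ''(s)` are arbitrarily small. -/
theorem exists_slow_cutoff {e : ℝ} (he : 0 < e) :
    ∃ κ κ₁ κ₂ : ℝ → ℝ, ContDiff ℝ ∞ κ ∧ (∀ s, HasDerivAt κ (κ₁ s) s) ∧
      (∀ s, HasDerivAt κ₁ (κ₂ s) s) ∧ (∀ s, 0 ≤ κ s ∧ κ s ≤ 1) ∧ (∀ s, |s * κ₁ s| ≤ e) ∧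
      (∀ s, |s ^ 2 * κ₂ s| ≤ e) ∧ (∀ s, 1 / 2 ≤ s → κ s = 1 ∧ κ₁ s = 0 ∧ κ₂ s = 0) ∧
      ∃ s₀ > 0, ∀ s, |s| ≤ s₀ → κ s = 0 := by
  obtain ⟨C, hC0, hC1, hC2⟩ := exists_bound_deriv_smoothTransition
  set θ := Real.smoothTransition with hθdef
  obtain ⟨ε, hε0, hε1, hεe⟩ : ∃ ε : ℝ, 0 < ε ∧ ε ≤ 1 ∧ 6 * C * ε ≤ e := by
    refine ⟨min 1 (e / (6 * C + 1)), by positivity, min_le_left _ _, ?_⟩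
    have h1 : min 1 (e / (6 * C + 1)) ≤ e / (6 * C + 1) := min_le_right _ _
    have h2 : (6 * C + 1) * (e / (6 * C + 1)) = e := by field_simp
    have h3 : 0 ≤ e / (6 * C + 1) := by positivity
    nlinarith
  -- For `s² ≤ δ` the argument of the logarithm in `l` is at most `32δ = exp(-1/ε)`, hence `l ≤ 0`
  -- and `κ = 0`. For `s > 1/4` it exceeds `1`, hence `l ≥ 1` and `κ = 1`.
  set δ : ℝ := Real.exp (-1 / ε) / 32 with hδ
  have hδ0 : 0 < δ := by positivity
  have hD : ∀ s : ℝ, 0 < s ^ 2 + δ := fun s => by positivity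
  have hθC : ContDiff ℝ 2 θ := Real.smoothTransition.contDiff
  have hθd : ∀ x, HasDerivAt θ (deriv θ x) x := fun x =>
    (hθC.differentiable (by simp) x).hasDerivAt
  have hθd2 : ∀ x, HasDerivAt (deriv θ) (deriv (deriv θ) x) x := fun x => by
    have := ((contDiff_succ_iff_deriv (n := 1)).1 (hθC.of_le (by norm_num))).2.2
    exact (this.differentiable (by simp) x).hasDerivAt
  set l : ℝ → ℝ := fun s => 1 + ε * Real.log (16 * (s ^ 2 + δ)) with hl
  have hden : ∀ s : ℝ, HasDerivAt (fun s : ℝ => s ^ 2 + δ) (2 * s) s := fun s => by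
    simpa using (hasDerivAt_pow 2 s).add_const δ
  have hld : ∀ s, HasDerivAt l (ε * (2 * s / (s ^ 2 + δ))) s := fun s => by
    have h1 := ((hden s).const_mul 16).log (by have := hD s; positivity)
    have h2 : 16 * (2 * s) / (16 * (s ^ 2 + δ)) = 2 * s / (s ^ 2 + δ) := by
      rw [mul_div_mul_left _ _ (by norm_num)]
    rw [h2] at h1
    exact (h1.const_mul ε).const_add 1
  set κ : ℝ → ℝ := fun s => θ (l s) with hκ
  set κ₁ : ℝ → ℝ := fun s => deriv θ (l s) * (ε * (2 * s / (s ^ 2 + δ))) with hκ₁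
  set κ₂ : ℝ → ℝ := fun s =>
    deriv (deriv θ) (l s) * (ε * (2 * s / (s ^ 2 + δ))) * (ε * (2 * s / (s ^ 2 + δ)))
      + deriv θ (l s) * (ε * ((2 * (s ^ 2 + δ) - 2 * s * (2 * s)) / (s ^ 2 + δ) ^ 2)) with hκ₂
  have h1 : ∀ s, HasDerivAt κ (κ₁ s) s := fun s => (hθd _).comp s (hld s)
  have h2 : ∀ s, HasDerivAt κ₁ (κ₂ s) s := fun s => by
    have h3 : HasDerivAt (fun s : ℝ => ε * (2 * s / (s ^ 2 + δ)))
        (ε * ((2 * (s ^ 2 + δ) - 2 * s * (2 * s)) / (s ^ 2 + δ) ^ 2)) s := by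
      have h4 : HasDerivAt (fun s : ℝ => 2 * s) 2 s := by
        simpa using (hasDerivAt_id s).const_mul 2
      exact (h4.div (hden s) (hD s).ne').const_mul ε
    exact ((hθd2 _).comp s (hld s)).mul h3
  have hone : ∀ s, 1 / 4 < s → κ s = 1 := fun s hs => by
    refine Real.smoothTransition.one_of_one_le ?_
    have h3 : 0 ≤ Real.log (16 * (s ^ 2 + δ)) := Real.log_nonneg (by nlinarith)
    simp only [hl]
    nlinarith [mul_nonneg hε0.le h3]
  have hκ1zero : ∀ s, 1 / 4 < s → κ₁ s = 0 := fun s hs => by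
    have h3 : κ =ᶠ[𝓝 s] fun _ => 1 := by
      filter_upwards [lt_mem_nhds hs] with t ht using hone t ht
    exact (h1 s).unique ((hasDerivAt_const s (1 : ℝ)).congr_of_eventuallyEq h3)
  have hκ2zero : ∀ s, 1 / 4 < s → κ₂ s = 0 := fun s hs => by
    have h3 : κ₁ =ᶠ[𝓝 s] fun _ => 0 := by
      filter_upwards [lt_mem_nhds hs] with t ht using hκ1zero t ht
    exact (h2 s).unique ((hasDerivAt_const s (0 : ℝ)).congr_of_eventuallyEq h3)
  have hratio : ∀ s : ℝ, 0 ≤ s ^ 2 / (s ^ 2 + δ) ∧ s ^ 2 / (s ^ 2 + δ) ≤ 1 := fun s =>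
    ⟨div_nonneg (sq_nonneg s) (hD s).le, (div_le_one (hD s)).2 (by linarith)⟩
  refine ⟨κ, κ₁, κ₂, ?_, h1, h2, fun s => ⟨Real.smoothTransition.nonneg _,
    Real.smoothTransition.le_one _⟩, fun s => ?_, fun s => ?_,
    fun s hs => ⟨hone s (by linarith), hκ1zero s (by linarith), hκ2zero s (by linarith)⟩,
    Real.sqrt δ, Real.sqrt_pos.2 hδ0, fun s hs => ?_⟩
  · refine Real.smoothTransition.contDiff.comp (contDiff_const.add (contDiff_const.mul ?_))
    exact ContDiff.log (by fun_prop) fun s => by have := hD s; positivity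
  · have h3 : s * κ₁ s = deriv θ (l s) * (2 * ε * (s ^ 2 / (s ^ 2 + δ))) := by
      simp only [hκ₁]
      ring
    obtain ⟨h4, h5⟩ := hratio s
    rw [h3, abs_mul, abs_of_nonneg (by positivity : 0 ≤ 2 * ε * (s ^ 2 / (s ^ 2 + δ)))]
    calc |deriv θ (l s)| * (2 * ε * (s ^ 2 / (s ^ 2 + δ))) ≤ C * (2 * ε * 1) := by
          gcongr
          exact hC1 _
      _ ≤ e := by nlinarith [mul_nonneg hC0 hε0.le]
  · obtain ⟨h4, h5⟩ := hratio s
    set r := s ^ 2 / (s ^ 2 + δ) with hr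
    have h3 : s ^ 2 * κ₂ s = deriv (deriv θ) (l s) * (4 * ε ^ 2 * r ^ 2)
        + deriv θ (l s) * (ε * (2 * r - 4 * r ^ 2)) := by
      have := (hD s).ne'
      simp only [hκ₂, hr]
      field_simp
      ring
    rw [h3]
    have h6 : |2 * r - 4 * r ^ 2| ≤ 2 := by
      rw [abs_le]
      constructor <;> nlinarith
    calc |deriv (deriv θ) (l s) * (4 * ε ^ 2 * r ^ 2) + deriv θ (l s) * (ε * (2 * r - 4 * r ^ 2))|
        ≤ |deriv (deriv θ) (l s)| * (4 * ε ^ 2 * r ^ 2)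
          + |deriv θ (l s)| * (ε * |2 * r - 4 * r ^ 2|) := by
          refine (abs_add_le _ _).trans (le_of_eq ?_)
          rw [abs_mul, abs_mul (deriv θ (l s)), abs_mul ε, abs_of_pos hε0,
            abs_of_nonneg (by positivity : 0 ≤ 4 * ε ^ 2 * r ^ 2)]
      _ ≤ C * (4 * ε ^ 2 * 1 ^ 2) + C * (ε * 2) := by
          gcongr
          · exact hC2 _
          · exact hC1 _
      _ ≤ e := by nlinarith [mul_nonneg hC0 (mul_nonneg hε0.le (sub_nonneg.2 hε1))]
  · refine Real.smoothTransition.zero_of_nonpos ?_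
    have h3 : s ^ 2 ≤ δ := by
      rw [← sq_abs, ← Real.sq_sqrt hδ0.le]
      gcongr
    have h4 : Real.log (16 * (s ^ 2 + δ)) ≤ -1 / ε := by
      rw [← Real.log_exp (-1 / ε)]
      refine Real.log_le_log (by have := hD s; positivity) ?_
      rw [hδ] at h3 ⊢
      linarith
    have h5 : ε * Real.log (16 * (s ^ 2 + δ)) ≤ ε * (-1 / ε) := by gcongr
    have h6 : ε * (-1 / ε) = -1 := by field_simp
    simp only [hl]
    linarith

/-- This is `|∇g|² < g Δg` for `g = 1 + y² + x² κ(x² + y²)`, that is, positivity of `Δ log g`, with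
`K`, `k₁`, `k₂` the values of `κ`, `κ'`, `κ''`. Where `κ ≡ 1` it is the Fubini–Study case. Inside,
without the derivatives of `κ` the difference of the two sides is at least `2 + 2K - 2(1 - K)y² ≥ 1`
because `y² < 1/2`, and the slow cutoff keeps the remaining terms below this margin. -/
theorem profile_positivity {x y K k₁ k₂ : ℝ} (hK0 : 0 ≤ K) (hK1 : K ≤ 1)
    (h1 : |(x ^ 2 + y ^ 2) * k₁| ≤ 1 / 100) (h2 : |(x ^ 2 + y ^ 2) ^ 2 * k₂| ≤ 1 / 100)
    (hout : 1 / 2 ≤ x ^ 2 + y ^ 2 → K = 1 ∧ k₁ = 0 ∧ k₂ = 0) :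
    (2 * x * K + 2 * x ^ 3 * k₁) ^ 2 + (2 * y + 2 * x ^ 2 * y * k₁) ^ 2
      < (2 + 2 * K + 12 * x ^ 2 * k₁ + 4 * x ^ 2 * (x ^ 2 + y ^ 2) * k₂)
        * (1 + (y ^ 2 + x ^ 2 * K)) := by
  rcases le_or_gt (1 / 2) (x ^ 2 + y ^ 2) with hs | hs
  · obtain ⟨rfl, rfl, rfl⟩ := hout hs
    nlinarith
  have hA : |x ^ 2 * k₁| ≤ 1 / 100 := by
    refine le_trans ?_ h1
    rw [abs_mul, abs_mul, abs_of_nonneg (sq_nonneg x),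
      abs_of_nonneg (by positivity : 0 ≤ x ^ 2 + y ^ 2)]
    gcongr
    nlinarith
  have hB : |x ^ 2 * (x ^ 2 + y ^ 2) * k₂| ≤ 1 / 100 := by
    refine le_trans ?_ h2
    rw [abs_mul, abs_mul _ k₂, abs_of_nonneg (by positivity : 0 ≤ x ^ 2 * (x ^ 2 + y ^ 2)),
      abs_of_nonneg (by positivity : 0 ≤ (x ^ 2 + y ^ 2) ^ 2), sq (x ^ 2 + y ^ 2)]
    gcongr
    nlinarith
  set A := x ^ 2 * k₁ with hAdef
  set B := x ^ 2 * (x ^ 2 + y ^ 2) * k₂ with hBdef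
  have e1 : (2 * x * K + 2 * x ^ 3 * k₁) ^ 2 + (2 * y + 2 * x ^ 2 * y * k₁) ^ 2
      = 4 * (x ^ 2 * (K + A) ^ 2) + 4 * (y ^ 2 * (1 + A) ^ 2) := by
    rw [hAdef]
    ring
  have e2 : 2 + 2 * K + 12 * x ^ 2 * k₁ + 4 * x ^ 2 * (x ^ 2 + y ^ 2) * k₂
      = 2 + 2 * K + (12 * A + 4 * B) := by
    rw [hAdef, hBdef]
    ring
  rw [e1, e2]
  obtain ⟨hA1, hA2⟩ := abs_le.1 hA
  obtain ⟨hB1, hB2⟩ := abs_le.1 hB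
  have g1 : (K + A) ^ 2 ≤ K ^ 2 + 3 / 100 := by nlinarith
  have g2 : (1 + A) ^ 2 ≤ 1 + 3 / 100 := by nlinarith
  have hx := sq_nonneg x
  have hy := sq_nonneg y
  have g3 : 4 * (x ^ 2 * (K + A) ^ 2) + 4 * (y ^ 2 * (1 + A) ^ 2)
      ≤ 4 * x ^ 2 * K ^ 2 + 4 * y ^ 2 + 6 / 100 := by nlinarith
  have g4 : (2 + 2 * K - 16 / 100) * (1 + (y ^ 2 + x ^ 2 * K))
      ≤ (2 + 2 * K + (12 * A + 4 * B)) * (1 + (y ^ 2 + x ^ 2 * K)) := by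
    gcongr
    linarith
  have hxK : x ^ 2 * K ≤ x ^ 2 := mul_le_of_le_one_right hx hK1
  have hxK2 : x ^ 2 * K ^ 2 ≤ x ^ 2 := mul_le_of_le_one_right hx (by nlinarith)
  have hxK3 : x ^ 2 * K ^ 2 ≤ x ^ 2 * K := by
    have : K ^ 2 ≤ K := by nlinarith
    gcongr
  nlinarith [mul_nonneg hK0 hy, mul_nonneg hx hK0]

/-- Strictly subharmonic nonnegative functions that vanish on the segment `[-2ρ, 2ρ]` and agree
with the Fubini-Study potential away from the origin. -/
structure IsProfile (H : ℂ → ℝ) (ρ : ℝ) : Prop where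
  contDiff : ContDiff ℝ ∞ H
  laplacian_pos : ∀ z, 0 < Laplacian.laplacian H z
  nonneg : ∀ z, 0 ≤ H z
  eq_fsPotential : ∀ z, 1 / 2 ≤ ‖z‖ ^ 2 → H z = fsPotential z
  eq_zero : ∀ t : ℝ, |t| ≤ 2 * ρ → H t = 0
  pos : 0 < ρ

/-- Take `H = log(1 + y² + x² κ(|z|²))`: a slow cutoff removes `x²` from the Fubini–Study potential
near the origin. There only `y²` is left, which vanishes on the real axis while its Laplacian stays
positive. -/
theorem exists_profile : ∃ H ρ, IsProfile H ρ := by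
  obtain ⟨κ, κ₁, κ₂, hκC, hκ1, hκ2, hκ01, hb1, hb2, hout, s₀, hs₀, hzero⟩ :=
    exists_slow_cutoff (e := 1 / 100) (by norm_num)
  set g : ℂ → ℝ := fun z => 1 + (z.im ^ 2 + z.re ^ 2 * κ (z.re ^ 2 + z.im ^ 2)) with hg
  have hre : ContDiff ℝ ∞ fun z : ℂ => z.re := Complex.reCLM.contDiff
  have him : ContDiff ℝ ∞ fun z : ℂ => z.im := Complex.imCLM.contDiff
  have hgC : ContDiff ℝ ∞ g := contDiff_const.add
    ((him.pow 2).add ((hre.pow 2).mul (hκC.comp ((hre.pow 2).add (him.pow 2)))))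
  have hq0 : ∀ z : ℂ, 0 ≤ z.im ^ 2 + z.re ^ 2 * κ (z.re ^ 2 + z.im ^ 2) := fun z => by
    have := (hκ01 (z.re ^ 2 + z.im ^ 2)).1
    positivity
  have hg0 : ∀ z, 0 < g z := fun z => by have := hq0 z; simp only [hg]; linarith
  -- With `2ρ = min 1 s₀`, a real `t` with `|t| ≤ 2ρ` satisfies `t² ≤ |t| ≤ s₀`, so `κ(t²) = 0`.
  refine ⟨fun z => Real.log (g z), min 1 s₀ / 2, hgC.log fun z => (hg0 z).ne', fun z => ?_,
    fun z => Real.log_nonneg (by have := hq0 z; simp only [hg]; linarith), fun z hz => ?_,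
    fun t ht => ?_, by positivity⟩
  · set x := z.re
    set y := z.im
    have hx : ∀ t : ℝ, HasDerivAt (fun s : ℝ => g (z + s • 1))
        (2 * (x + t) * κ ((x + t) ^ 2 + y ^ 2)
          + (x + t) ^ 2 * (κ₁ ((x + t) ^ 2 + y ^ 2) * (2 * (x + t)))) t := fun t => by
      have h1 := (hκ1 ((x + t) ^ 2 + y ^ 2)).comp t ((hasDerivAt_add_sq x t).add_const (y ^ 2))
      have h2 := (((hasDerivAt_add_sq x t).mul h1).const_add (y ^ 2)).const_add 1
      simpa [hg, x, y] using h2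
    have hy : ∀ t : ℝ, HasDerivAt (fun s : ℝ => g (z + s • Complex.I))
        (2 * (y + t) + x ^ 2 * (κ₁ (x ^ 2 + (y + t) ^ 2) * (2 * (y + t)))) t := fun t => by
      have h1 := (hκ1 (x ^ 2 + (y + t) ^ 2)).comp t ((hasDerivAt_add_sq y t).const_add (x ^ 2))
      have h2 := ((hasDerivAt_add_sq y t).add (h1.const_mul (x ^ 2))).const_add 1
      simpa [hg, x, y] using h2
    have hxx : HasDerivAt (fun t : ℝ => 2 * (x + t) * κ ((x + t) ^ 2 + y ^ 2)
          + (x + t) ^ 2 * (κ₁ ((x + t) ^ 2 + y ^ 2) * (2 * (x + t))))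
        (2 * κ (x ^ 2 + y ^ 2) + 10 * x ^ 2 * κ₁ (x ^ 2 + y ^ 2)
          + 4 * x ^ 4 * κ₂ (x ^ 2 + y ^ 2)) 0 := by
      have h0 := (hasDerivAt_add_sq x 0).add_const (y ^ 2)
      have h1 := (hκ1 ((x + 0) ^ 2 + y ^ 2)).comp 0 h0
      have h2 := (hκ2 ((x + 0) ^ 2 + y ^ 2)).comp 0 h0
      have h3 := ((hasDerivAt_two_mul_add x 0).mul h1).add
        ((hasDerivAt_add_sq x 0).mul (h2.mul (hasDerivAt_two_mul_add x 0)))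
      refine h3.congr_deriv ?_
      simp only [add_zero, Function.comp_apply, Pi.mul_apply]
      ring
    have hyy : HasDerivAt (fun t : ℝ => 2 * (y + t)
          + x ^ 2 * (κ₁ (x ^ 2 + (y + t) ^ 2) * (2 * (y + t))))
        (2 + 2 * x ^ 2 * κ₁ (x ^ 2 + y ^ 2) + 4 * x ^ 2 * y ^ 2 * κ₂ (x ^ 2 + y ^ 2)) 0 := by
      have h0 := (hasDerivAt_add_sq y 0).const_add (x ^ 2)
      have h2 := (hκ2 (x ^ 2 + (y + 0) ^ 2)).comp 0 h0
      have h3 := (hasDerivAt_two_mul_add y 0).add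
        ((h2.mul (hasDerivAt_two_mul_add y 0)).const_mul (x ^ 2))
      refine h3.congr_deriv ?_
      simp only [add_zero, Function.comp_apply]
      ring
    rw [laplacian_log_eq (hgC.of_le (WithTop.coe_le_coe.2 le_top)) hg0 hx hxx hy hyy]
    refine div_pos ?_ (pow_pos (hg0 z) 2)
    have h4 := profile_positivity (x := x) (y := y) (hκ01 _).1 (hκ01 _).2 (hb1 (x ^ 2 + y ^ 2))
      (hb2 (x ^ 2 + y ^ 2)) (hout (x ^ 2 + y ^ 2))
    simp only [hg, add_zero]
    refine sub_pos.2 (lt_of_eq_of_lt ?_ (lt_of_lt_of_eq h4 ?_))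
    · ring
    · simp only [x, y]
      ring
  · rw [norm_sq_eq_re_im] at hz
    simp only [hg, (hout _ hz).1, fsPotential, norm_sq_eq_re_im]
    congr 1
    ring
  · have h1 : |(t : ℝ) ^ 2| ≤ s₀ := by
      have h2 : |t| ≤ min 1 s₀ := by linarith
      have h3 := h2.trans (min_le_left _ _)
      have h4 := h2.trans (min_le_right _ _)
      rw [abs_pow]
      nlinarith [abs_nonneg t]
    simp [hg, hzero _ h1]

/-! ### The rotated boundary data. -/

theorem contDiff_fsPotential {n : WithTop ℕ∞} : ContDiff ℝ n fsPotential := by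
  unfold fsPotential
  exact (contDiff_const.add (contDiff_norm_sq ℝ)).log fun z => by positivity

theorem laplacian_fsPotential_pos (z : ℂ) : 0 < Laplacian.laplacian fsPotential z := by
  have h : Laplacian.laplacian fsPotential z = 4 * 1 / (1 + ‖z‖ ^ 2) ^ 2 :=
    laplacian_log_add_norm_sq one_pos z
  rw [h]
  positivity

theorem fsPotential_inv {z : ℂ} (hz : z ≠ 0) :
    fsPotential z⁻¹ = fsPotential z - 2 * Real.log ‖z‖ := by
  have h : 0 < ‖z‖ := norm_pos_iff.2 hz
  have h1 : 1 + ‖z⁻¹‖ ^ 2 = (1 + ‖z‖ ^ 2) / ‖z‖ ^ 2 := by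
    rw [norm_inv]
    field_simp
    ring
  rw [fsPotential, fsPotential, h1, Real.log_div (by positivity) (by positivity), Real.log_pow]
  push_cast
  ring

/-- Potentials on `P1` with prescribed difference `H` to `0` in the chart `chartW`, rotated
by `τ`. -/
noncomputable def rotatedPotential (H : ℂ → ℝ) (τ : Circle) (x : P1) : ℝ :=
  OnePoint.elim x 0 fun z => H (z * τ)⁻¹ - fsPotential (z * τ)⁻¹

theorem rotatedPotential_chartZ (H : ℂ → ℝ) (τ : Circle) (z : ℂ) :
    rotatedPotential H τ (chartZ z) = H (z * τ)⁻¹ - fsPotential (z * τ)⁻¹ := rfl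

theorem fsPotential_zero : fsPotential 0 = 0 := by simp [fsPotential]

theorem fsPotential_congr_norm {z w : ℂ} (h : ‖z‖ = ‖w‖) : fsPotential z = fsPotential w := by
  rw [fsPotential, fsPotential, h]

theorem norm_mul_circle_inv (w : ℂ) (τ : Circle) : ‖w * (τ : ℂ)⁻¹‖ = ‖w‖ := by
  rw [norm_mul, norm_inv, Circle.norm_coe, inv_one, mul_one]

namespace IsProfile

variable {H : ℂ → ℝ} {ρ : ℝ}

theorem map_zero (hH : IsProfile H ρ) : H 0 = 0 := by
  have := hH.eq_zero 0 (by have := hH.pos; simpa using this.le)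
  simpa using this

theorem rotatedPotential_chartW (hH : IsProfile H ρ) (τ : Circle) (w : ℂ) :
    rotatedPotential H τ (chartW w) = H (w * (τ : ℂ)⁻¹) - fsPotential (w * (τ : ℂ)⁻¹) := by
  rcases eq_or_ne w 0 with rfl | hw
  · rw [chartW_zero]
    simp [rotatedPotential, hH.map_zero, fsPotential_zero]
  · rw [chartW_of_ne hw, rotatedPotential_chartZ, mul_inv, inv_inv]

theorem rotatedPotential_chartZ_eq_zero (hH : IsProfile H ρ) (τ : Circle) {z : ℂ} (hz : ‖z‖ < 1) :
    rotatedPotential H τ (chartZ z) = 0 := by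
  rw [rotatedPotential_chartZ]
  rcases eq_or_ne z 0 with rfl | h0
  · simp [hH.map_zero, fsPotential_zero]
  · have h1 : 1 ≤ ‖(z * (τ : ℂ))⁻¹‖ := by
      rw [norm_inv, norm_mul, Circle.norm_coe, mul_one]
      exact (one_le_inv₀ (norm_pos_iff.2 h0)).2 hz.le
    rw [hH.eq_fsPotential _ (by nlinarith), sub_self]

theorem isSmoothFamily (hH : IsProfile H ρ) : IsSmoothFamily (rotatedPotential H) := by
  have hf : ContDiff ℝ ∞ fun w => H w - fsPotential w := hH.contDiff.sub contDiff_fsPotential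
  have hexp : ContDiff ℝ ∞ fun t : ℝ => (Circle.exp t : ℂ) := by
    simp only [Circle.coe_exp]
    exact Complex.contDiff_exp.comp (Complex.ofRealCLM.contDiff.mul contDiff_const)
  have hexp' : ContDiff ℝ ∞ fun q : ℝ × ℂ => (Circle.exp q.1 : ℂ) := hexp.comp contDiff_fst
  rintro c (rfl | rfl)
  · rw [contDiff_iff_contDiffAt]
    intro q
    by_cases hq : q.2 = 0
    · have h1 : ∀ᶠ p : ℝ × ℂ in 𝓝 q, ‖p.2‖ < 1 :=
        ContinuousAt.eventually_lt (by fun_prop) continuousAt_const (by simp [hq])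
      refine (contDiffAt_const (c := (0 : ℝ))).congr_of_eventuallyEq ?_
      filter_upwards [h1] with p hp using hH.rotatedPotential_chartZ_eq_zero _ hp
    · simp only [rotatedPotential_chartZ]
      have h1 : ContDiffAt ℝ ∞ (fun q : ℝ × ℂ => (q.2 * (Circle.exp q.1 : ℂ))⁻¹) q :=
        (contDiff_snd.mul hexp').contDiffAt.inv (mul_ne_zero hq (Circle.coe_ne_zero _))
      exact hf.contDiffAt.comp q h1
  · simp only [hH.rotatedPotential_chartW]
    exact hf.comp (contDiff_snd.mul (hexp'.inv fun q => Circle.coe_ne_zero _))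

/-- In the coordinate `w` the total potential is `H` after a rotation. In the coordinate `z ≠ 0` it
is `H` after a holomorphic change of variable plus the harmonic `2 log|z|`, and near `z = 0` it is
the Fubini–Study potential. -/
theorem isKahlerPotential (hH : IsProfile H ρ) (τ : Circle) :
    IsKahlerPotential (rotatedPotential H τ) := by
  intro c hc
  obtain ⟨t, rfl⟩ := Circle.exp_surjective τ
  refine ⟨(hH.isSmoothFamily c hc).comp (contDiff_const.prodMk contDiff_id), fun ζ => ?_⟩
  set τ := Circle.exp t
  have hH2 : ContDiff ℝ 2 H := hH.contDiff.of_le (WithTop.coe_le_coe.2 le_top)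
  rcases hc with rfl | rfl
  · by_cases hζ : ζ = 0
    · have h1 : (fun ξ => fsPotential ξ + rotatedPotential H τ (chartZ ξ)) =ᶠ[𝓝 ζ]
          fsPotential := by
        have h2 : ∀ᶠ ξ : ℂ in 𝓝 ζ, ‖ξ‖ < 1 :=
          ContinuousAt.eventually_lt (by fun_prop) continuousAt_const (by simp [hζ])
        filter_upwards [h2] with ξ hξ
        rw [hH.rotatedPotential_chartZ_eq_zero _ hξ, add_zero]
      rw [(InnerProductSpace.laplacian_congr_nhds h1).eq_of_nhds]
      exact laplacian_fsPotential_pos ζ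
    · set j : ℂ → ℂ := fun ξ => (ξ * (τ : ℂ))⁻¹ with hj
      have hτ0 : (τ : ℂ) ≠ 0 := Circle.coe_ne_zero _
      have hζτ : ζ * (τ : ℂ) ≠ 0 := mul_ne_zero hζ hτ0
      have hja : AnalyticAt ℂ j ζ := (analyticAt_id.mul analyticAt_const).inv hζτ
      have hjd : deriv j ζ ≠ 0 := by
        have h1 : HasDerivAt j (-(1 * (τ : ℂ)) / (ζ * τ) ^ 2) ζ :=
          ((hasDerivAt_id ζ).mul_const (τ : ℂ)).inv hζτ
        rw [h1.deriv]
        exact div_ne_zero (by simp) (pow_ne_zero 2 hζτ)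
      have hharm : InnerProductSpace.HarmonicAt (fun ξ : ℂ => Real.log ‖ξ‖) ζ :=
        AnalyticAt.harmonicAt_log_norm analyticAt_id hζ
      have h1 : (fun ξ => fsPotential ξ + rotatedPotential H τ (chartZ ξ)) =ᶠ[𝓝 ζ]
          (H ∘ j) + (2 : ℝ) • fun ξ : ℂ => Real.log ‖ξ‖ := by
        filter_upwards [isOpen_ne.mem_nhds hζ] with ξ hξ
        have h2 : fsPotential (ξ * (τ : ℂ))⁻¹ = fsPotential ξ - 2 * Real.log ‖ξ‖ := by
          rw [← fsPotential_inv hξ]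
          refine fsPotential_congr_norm ?_
          rw [mul_inv, norm_mul_circle_inv]
        simp only [rotatedPotential_chartZ, h2, Pi.add_apply, Pi.smul_apply, Function.comp_apply,
          smul_eq_mul, hj]
        ring
      have hlogC : ContDiffAt ℝ 2 (fun ξ : ℂ => Real.log ‖ξ‖) ζ := hharm.1
      rw [(InnerProductSpace.laplacian_congr_nhds h1).eq_of_nhds,
        (hH2.contDiffAt.comp ζ (contDiffAt_real_of_analyticAt hja)).laplacian_add
          (show ContDiffAt ℝ 2 ((2 : ℝ) • fun ξ : ℂ => Real.log ‖ξ‖) ζ from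
            contDiffAt_const.smul hlogC),
        InnerProductSpace.laplacian_smul _ hlogC, hharm.2.eq_of_nhds,
        laplacian_comp_analytic hja hH2.contDiffAt]
      simp only [Pi.zero_apply, smul_zero, add_zero]
      exact mul_pos (pow_pos (norm_pos_iff.2 hjd) 2) (hH.laplacian_pos _)
  · have h1 : (fun ξ => fsPotential ξ + rotatedPotential H τ (chartW ξ))
        = H ∘ fun ξ => ξ * (τ : ℂ)⁻¹ := by
      funext ξ
      rw [hH.rotatedPotential_chartW, fsPotential_congr_norm (norm_mul_circle_inv ξ τ)]
      simp
    have h2 : deriv (fun ξ : ℂ => ξ * (τ : ℂ)⁻¹) ζ = (τ : ℂ)⁻¹ := by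
      simp
    have h3 : AnalyticAt ℂ (fun ξ : ℂ => ξ * (τ : ℂ)⁻¹) ζ := by fun_prop
    rw [h1, laplacian_comp_analytic h3 hH2.contDiffAt, h2,
      norm_inv, Circle.norm_coe]
    simpa using hH.laplacian_pos _

/-- The difference between `H` and the Fubini–Study potential is smooth with compact support, hence
Lipschitz, and rotating a point with `|w| ≤ 1` moves it by at most `|τ - σ|`. The rest of the sphere
is `|z| < 1`, where the data vanish. -/
theorem exists_lipschitz (hH : IsProfile H ρ) : ∃ L : ℝ, ∀ (τ σ : Circle) (x : P1),
    |rotatedPotential H τ x - rotatedPotential H σ x| ≤ L * ‖(τ : ℂ) - σ‖ := by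
  have hf : ContDiff ℝ 1 fun w => H w - fsPotential w :=
    (hH.contDiff.of_le (WithTop.coe_le_coe.2 le_top)).sub contDiff_fsPotential
  have hsupp : HasCompactSupport fun w => H w - fsPotential w := by
    refine HasCompactSupport.of_support_subset_isCompact (isCompact_closedBall (0 : ℂ) 1) ?_
    intro w hw
    by_contra h
    rw [mem_closedBall_zero_iff, not_le] at h
    exact hw (sub_eq_zero.2 (hH.eq_fsPotential w (by nlinarith)))
  obtain ⟨L, hL⟩ := hf.lipschitzWith_of_hasCompactSupport hsupp one_ne_zero
  refine ⟨L, fun τ σ x => ?_⟩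
  have hz : ∀ {z : ℂ}, ‖z‖ < 1 → |rotatedPotential H τ (chartZ z) - rotatedPotential H σ (chartZ z)|
      ≤ L * ‖(τ : ℂ) - σ‖ := fun h => by
    rw [hH.rotatedPotential_chartZ_eq_zero τ h, hH.rotatedPotential_chartZ_eq_zero σ h, sub_self,
      abs_zero]
    positivity
  have hw : ∀ {w : ℂ}, ‖w‖ ≤ 1 → |rotatedPotential H τ (chartW w) - rotatedPotential H σ (chartW w)|
      ≤ L * ‖(τ : ℂ) - σ‖ := fun {w} h => by
    rw [hH.rotatedPotential_chartW, hH.rotatedPotential_chartW, ← Real.dist_eq]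
    refine (hL.dist_le_mul _ _).trans ?_
    gcongr
    rw [dist_eq_norm, ← mul_sub, norm_mul, ← Circle.coe_inv, ← Circle.coe_inv,
      Circle.coe_inv_eq_conj, Circle.coe_inv_eq_conj, ← map_sub, RCLike.norm_conj]
    exact mul_le_of_le_one_left (norm_nonneg _) h
  induction x using OnePoint.rec with
  | infty =>
    rw [← chartW_zero]
    exact hw (by simp)
  | coe z =>
    rcases lt_or_ge ‖z‖ 1 with h | h
    · exact hz h
    · have h0 : z ≠ 0 := norm_pos_iff.1 (by linarith)
      have h1 := hw (w := z⁻¹) (by rw [norm_inv]; exact inv_le_one_of_one_le₀ h)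
      rwa [chartW_of_ne (inv_ne_zero h0), inv_inv] at h1

/-- The weak solution has nonpositive local potential near `w = 0`. -/
theorem le_zero_of_candidate (hH : IsProfile H ρ) {ψ : P1 × ℂ → EReal}
    (hψ : IsCandidate (rotatedPotential H) ψ) {w τ : ℂ} (hτ : ‖τ‖ < 1)
    (hw : ‖w‖ ≤ ρ * (1 - ‖τ‖ ^ 2)) : (fsPotential w : EReal) + ψ (chartW w, τ) ≤ 0 := by
  have hW : chartW ∈ charts := by simp [charts]
  refine le_zero_of_le_zero_on_rotating_segment (hψ.psh _ hW)
    (upperSemicontinuousOn_chart hψ.usc hW)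
    (fun p hp => EReal.add_ne_top (EReal.coe_ne_top _) (hψ.ne_top _ ⟨Set.mem_univ _, hp.2⟩))
    hH.pos.le (fun t s ht hs => ?_) hτ hw
  obtain ⟨t, rfl⟩ : ∃ t' : Circle, (t' : ℂ) = t :=
    ⟨⟨t, by simpa [Submonoid.unitSphere] using ht⟩, rfl⟩
  have h1 := hψ.boundary_le t (chartW (s * t))
  rw [← EReal.coe_zero, coe_add_le_coe_iff]
  refine h1.trans (EReal.coe_le_coe_iff.2 (le_of_eq ?_))
  have h2 : (s : ℂ) * t * (t : ℂ)⁻¹ = s := by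
    rw [mul_assoc, mul_inv_cancel₀ (Circle.coe_ne_zero _), mul_one]
  have h3 : fsPotential ((s : ℂ) * t) = fsPotential s :=
    fsPotential_congr_norm (by rw [norm_mul, Circle.norm_coe, mul_one])
  rw [hH.rotatedPotential_chartW, h2, hH.eq_zero s hs, h3]

end IsProfile

/-! ### Explicit candidates: the lower bound and the zero set. -/

/-- The function on `P1` whose total potential in the chart `chartW` is
`log (1 + δ |w|²) - log (1 + δ)`. -/
noncomputable def lowerPotential (δ : ℝ) (x : P1) : ℝ :=
  OnePoint.elim x (-Real.log (1 + δ))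
    fun z => Real.log (δ + ‖z‖ ^ 2) - fsPotential z - Real.log (1 + δ)

theorem lowerPotential_chartZ (δ : ℝ) (z : ℂ) : lowerPotential δ (chartZ z)
    = Real.log (δ + ‖z‖ ^ 2) - fsPotential z - Real.log (1 + δ) := rfl

theorem lowerPotential_chartW {δ : ℝ} (hδ : 0 < δ) (w : ℂ) : lowerPotential δ (chartW w)
    = Real.log (1 + δ * ‖w‖ ^ 2) - fsPotential w - Real.log (1 + δ) := by
  rcases eq_or_ne w 0 with rfl | hw
  · rw [chartW_zero]
    simp [lowerPotential, fsPotential_zero]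
  · have h : 0 < ‖w‖ := norm_pos_iff.2 hw
    have h1 : δ + ‖w⁻¹‖ ^ 2 = (1 + δ * ‖w‖ ^ 2) / ‖w‖ ^ 2 := by
      rw [norm_inv]
      field_simp
      ring
    rw [chartW_of_ne hw, lowerPotential_chartZ, fsPotential_inv hw, h1,
      Real.log_div (by positivity) (by positivity), Real.log_pow]
    push_cast
    ring

theorem laplacian_sub_const {g : ℂ → ℝ} (hg : ContDiff ℝ 2 g) (a : ℝ) (z : ℂ) :
    Laplacian.laplacian (fun w => g w - a) z = Laplacian.laplacian g z := by
  have h := hg.contDiffAt.laplacian_sub (x := z) (contDiffAt_const (c := a))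
  rw [InnerProductSpace.laplacian_const] at h
  simpa [Pi.sub_def] using h

theorem laplacian_lowerPotential_nonneg {δ : ℝ} (hδ : 0 < δ) {c : ℂ → P1} (hc : c ∈ charts) :
    ContDiff ℝ 2 (fun ζ : ℂ => lowerPotential δ (c ζ)) ∧
      ∀ ζ : ℂ, 0 ≤ Laplacian.laplacian (fun ξ : ℂ => fsPotential ξ + lowerPotential δ (c ξ)) ζ := by
  have key : ∀ {a : ℝ}, 0 < a → ContDiff ℝ 2 fun w : ℂ => Real.log (a + ‖w‖ ^ 2) := fun ha =>
    (contDiff_const.add (contDiff_norm_sq ℝ)).log fun z => by positivity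
  have hpos : ∀ {a : ℝ}, 0 < a → ∀ z : ℂ,
      0 ≤ Laplacian.laplacian (fun w : ℂ => Real.log (a + ‖w‖ ^ 2)) z := fun ha z => by
    rw [laplacian_log_add_norm_sq ha]
    positivity
  rcases hc with rfl | rfl
  · refine ⟨((key hδ).sub contDiff_fsPotential).sub contDiff_const, fun ζ => ?_⟩
    have h1 : (fun ξ : ℂ => fsPotential ξ + lowerPotential δ (chartZ ξ))
        = fun ξ : ℂ => Real.log (δ + ‖ξ‖ ^ 2) - Real.log (1 + δ) := by
      funext ξ
      rw [lowerPotential_chartZ]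
      ring
    rw [h1, laplacian_sub_const (key hδ)]
    exact hpos hδ ζ
  · have h1 : ∀ ξ : ℂ, lowerPotential δ (chartW ξ)
        = Real.log (δ⁻¹ + ‖ξ‖ ^ 2) - fsPotential ξ - (Real.log (1 + δ) - Real.log δ) := fun ξ => by
      have h2 : 1 + δ * ‖ξ‖ ^ 2 = δ * (δ⁻¹ + ‖ξ‖ ^ 2) := by field_simp
      rw [lowerPotential_chartW hδ, h2, Real.log_mul hδ.ne' (by positivity)]
      ring
    have h3 : 0 < δ⁻¹ := by positivity
    simp only [h1]
    refine ⟨((key h3).sub contDiff_fsPotential).sub contDiff_const, fun ζ => ?_⟩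
    have h4 : (fun ξ : ℂ => fsPotential ξ + (Real.log (δ⁻¹ + ‖ξ‖ ^ 2) - fsPotential ξ
        - (Real.log (1 + δ) - Real.log δ)))
        = fun ξ : ℂ => Real.log (δ⁻¹ + ‖ξ‖ ^ 2) - (Real.log (1 + δ) - Real.log δ) := by
      funext ξ
      ring
    rw [h4, laplacian_sub_const (key h3)]
    exact hpos h3 ζ

namespace IsProfile

variable {H : ℂ → ℝ} {ρ : ℝ}

/-- For `|w| ≥ 1` the total potential is at most the Fubini–Study potential, which is `H` there,
because `δ ≤ 1`. For `|w| < 1` it is at most `0 ≤ H`; the constant `log(1 + δ)` is subtracted for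
this. -/
theorem isCandidate_lowerPotential (hH : IsProfile H ρ) {δ : ℝ} (hδ : 0 < δ) (hδ1 : δ ≤ 1) :
    IsCandidate (rotatedPotential H) fun p => (lowerPotential δ p.1 : EReal) := by
  have hlog : 0 ≤ Real.log (1 + δ) := Real.log_nonneg (by linarith)
  have h := isCandidate_of_contDiff (φ := rotatedPotential H) (f := lowerPotential δ)
    (k := fun _ => 0) (fun c hc => laplacian_lowerPotential_nonneg hδ hc)
    (differentiable_const _) fun τ x => ?_
  · simpa using h
  rw [Complex.zero_re, add_zero]
  have hw : ∀ w : ℂ, lowerPotential δ (chartW w) ≤ rotatedPotential H τ (chartW w) := fun w => by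
    rw [lowerPotential_chartW hδ, hH.rotatedPotential_chartW,
      fsPotential_congr_norm (norm_mul_circle_inv w τ)]
    rcases le_or_gt 1 ‖w‖ with h1 | h1
    · rw [hH.eq_fsPotential _ (by rw [norm_mul_circle_inv]; nlinarith),
        fsPotential_congr_norm (norm_mul_circle_inv w τ)]
      have h2 : Real.log (1 + δ * ‖w‖ ^ 2) ≤ fsPotential w := by
        refine Real.log_le_log (by positivity) ?_
        nlinarith [sq_nonneg ‖w‖]
      linarith
    · have h2 : Real.log (1 + δ * ‖w‖ ^ 2) ≤ Real.log (1 + δ) := by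
        refine Real.log_le_log (by positivity) ?_
        have : ‖w‖ ^ 2 ≤ 1 := pow_le_one₀ (norm_nonneg _) h1.le
        nlinarith
      linarith [hH.nonneg (w * (τ : ℂ)⁻¹)]
  induction x using OnePoint.rec with
  | infty => exact chartW_zero ▸ hw 0
  | coe z =>
    rcases eq_or_ne z 0 with rfl | h0
    · have h1 := hH.rotatedPotential_chartZ_eq_zero τ (z := 0) (by simp)
      rw [← chartZ, h1, lowerPotential_chartZ]
      have h2 : Real.log (δ + ‖(0 : ℂ)‖ ^ 2) ≤ 0 := by
        simpa using Real.log_nonpos hδ.le hδ1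
      rw [fsPotential_zero]
      linarith
    · have h1 := hw z⁻¹
      rwa [chartW_of_ne (inv_ne_zero h0), inv_inv] at h1

theorem lower_bound (hH : IsProfile H ρ) {Φ : P1 × ℂ → ℝ}
    (hΦ : IsWeakSolution (rotatedPotential H) Φ) {δ : ℝ} (hδ : 0 < δ) (hδ1 : δ ≤ 1) (w : ℂ) {τ : ℂ}
    (hτ : ‖τ‖ ≤ 1) : Real.log (1 + δ * ‖w‖ ^ 2) - Real.log (1 + δ)
      ≤ fsPotential w + Φ (chartW w, τ) := by
  have h1 := le_envelope (hH.isCandidate_lowerPotential hδ hδ1) (chartW w, τ)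
  rw [← hΦ.eq_envelope _ ⟨Set.mem_univ _, mem_closedBall_zero_iff.2 hτ⟩,
    EReal.coe_le_coe_iff, lowerPotential_chartW hδ] at h1
  linarith

theorem potential_nonneg (hH : IsProfile H ρ) {Φ : P1 × ℂ → ℝ}
    (hΦ : IsWeakSolution (rotatedPotential H) Φ) (w : ℂ) {τ : ℂ} (hτ : ‖τ‖ ≤ 1) :
    0 ≤ fsPotential w + Φ (chartW w, τ) := by
  have hlim : Filter.Tendsto (fun δ : ℝ => Real.log (1 + δ * ‖w‖ ^ 2) - Real.log (1 + δ)) (𝓝[>] 0)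
      (𝓝 0) := by
    have : ContinuousAt (fun δ : ℝ => Real.log (1 + δ * ‖w‖ ^ 2) - Real.log (1 + δ)) 0 :=
      (ContinuousAt.log (by fun_prop) (by simp)).sub (ContinuousAt.log (by fun_prop) (by simp))
    simpa using this.tendsto.mono_left (nhdsWithin_le_nhds (s := Set.Ioi 0))
  refine le_of_tendsto hlim ?_
  have h1 : ∀ᶠ δ : ℝ in 𝓝[>] 0, δ < 1 := nhdsWithin_le_nhds (gt_mem_nhds one_pos)
  filter_upwards [h1, self_mem_nhdsWithin] with δ h2 h3
  exact hH.lower_bound hΦ h3 h2.le w hτ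

theorem potential_eq_zero (hH : IsProfile H ρ) {Φ : P1 × ℂ → ℝ}
    (hΦ : IsWeakSolution (rotatedPotential H) Φ) {w τ : ℂ} (hτ : ‖τ‖ < 1)
    (hw : ‖w‖ ≤ ρ * (1 - ‖τ‖ ^ 2)) : fsPotential w + Φ (chartW w, τ) = 0 := by
  refine le_antisymm ?_ (hH.potential_nonneg hΦ w hτ.le)
  have h1 := hH.le_zero_of_candidate hΦ.candidate hτ hw
  rw [← EReal.coe_zero] at h1
  exact_mod_cast h1

end IsProfile

/-! ### Testing currents: integration by parts. -/

theorem leviForm_eq_fderiv {χ : ℂ × ℂ → ℝ} (hχ : ContDiff ℝ 2 χ) (p b : ℂ × ℂ) :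
    leviForm χ p b = fderiv ℝ (fderiv ℝ χ) p b b
      + fderiv ℝ (fderiv ℝ χ) p (Complex.I • b) (Complex.I • b) := by
  have hC : ContDiff ℝ 2 fun ζ : ℂ => χ (p + ζ • b) := hχ.comp (by fun_prop)
  have key : ∀ v : ℂ, fderiv ℝ (fderiv ℝ fun ζ : ℂ => χ (p + ζ • b)) 0 v v
      = fderiv ℝ (fderiv ℝ χ) p (v • b) (v • b) := fun v => by
    refine fderiv_fderiv_eq_of_line hC.contDiffAt ?_
      (hasDerivAt_fderiv_comp_line hχ.contDiffAt (v • b))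
    have h := eventually_hasDerivAt_comp_line (x := p) hχ.contDiffAt (v • b)
    simpa only [zero_add, smul_assoc] using h
  rw [leviForm, laplacian_eq_fderiv, key, key, one_smul]

theorem leviForm_eq_zero_of_notMem_tsupport {χ : ℂ × ℂ → ℝ} {p : ℂ × ℂ} (hp : p ∉ tsupport χ)
    (b : ℂ × ℂ) : leviForm χ p b = 0 := by
  have h1 : χ =ᶠ[𝓝 p] fun _ => 0 := notMem_tsupport_iff_eventuallyEq.1 hp
  have h2 : Filter.Tendsto (fun ζ : ℂ => p + ζ • b) (𝓝 0) (𝓝 p) := by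
    have : Continuous fun ζ : ℂ => p + ζ • b := by fun_prop
    simpa using this.tendsto 0
  have h3 : (fun ζ : ℂ => χ (p + ζ • b)) =ᶠ[𝓝 0] fun _ => 0 := h2.eventually h1
  rw [leviForm, (InnerProductSpace.laplacian_congr_nhds h3).eq_of_nhds,
    InnerProductSpace.laplacian_const]
  rfl

/-- Integrating by parts twice in a fixed direction. -/
theorem integral_mul_fderiv_fderiv {E : Type*} [NormedAddCommGroup E] [NormedSpace ℝ E]
    [FiniteDimensional ℝ E] [MeasurableSpace E] [BorelSpace E] {μ : MeasureTheory.Measure E}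
    [μ.IsAddHaarMeasure] {f χ : E → ℝ} (hf : ContDiff ℝ 2 f) (hχ : ContDiff ℝ 2 χ)
    (hsupp : HasCompactSupport χ) (v : E) :
    ∫ q, f q * fderiv ℝ (fderiv ℝ χ) q v v ∂μ = ∫ q, fderiv ℝ (fderiv ℝ f) q v v * χ q ∂μ := by
  have hC : ∀ {g : E → ℝ}, ContDiff ℝ 2 g → ContDiff ℝ 1 fun q => fderiv ℝ g q v := fun hg =>
    (hg.fderiv_right (m := 1) (by norm_num)).clm_apply contDiff_const
  have hd : ∀ {g : E → ℝ}, ContDiff ℝ 2 g → ∀ q,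
      fderiv ℝ (fun q => fderiv ℝ g q v) q v = fderiv ℝ (fderiv ℝ g) q v v := fun hg q => by
    rw [fderiv_clm_apply ((hg.fderiv_right (m := 1) (by norm_num)).differentiable (by simp) q)
      (differentiableAt_const v)]
    simp
  have hcont : ∀ {g : E → ℝ}, ContDiff ℝ 2 g →
      Continuous fun q => fderiv ℝ (fderiv ℝ g) q v v := fun hg => by
    have := ((hC hg).continuous_fderiv one_ne_zero).clm_apply (continuous_const (y := v))
    simpa only [hd hg] using this
  have hs1 : HasCompactSupport fun q => fderiv ℝ χ q v := hsupp.fderiv_apply (𝕜 := ℝ) v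
  have hs2 : HasCompactSupport fun q => fderiv ℝ (fderiv ℝ χ) q v v := by
    have := hs1.fderiv_apply (𝕜 := ℝ) v
    simpa only [hd hχ] using this
  have e1 := integral_mul_fderiv_eq_neg_fderiv_mul_of_integrable (μ := μ) (f := f)
    (g := fun q => fderiv ℝ χ q v) (v := v)
    (((hC hf).continuous.mul (hC hχ).continuous).integrable_of_hasCompactSupport hs1.mul_left)
    (by
      simp only [hd hχ]
      exact (hf.continuous.mul (hcont hχ)).integrable_of_hasCompactSupport hs2.mul_left)
    ((hf.continuous.mul (hC hχ).continuous).integrable_of_hasCompactSupport hs1.mul_left)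
    (fun q _ => hf.differentiable (by simp) q) (fun q _ => (hC hχ).differentiable (by simp) q)
  have e2 := integral_mul_fderiv_eq_neg_fderiv_mul_of_integrable (μ := μ)
    (f := fun q => fderiv ℝ f q v) (g := χ) (v := v)
    (by
      simp only [hd hf]
      exact ((hcont hf).mul hχ.continuous).integrable_of_hasCompactSupport hsupp.mul_left)
    (((hC hf).continuous.mul (hC hχ).continuous).integrable_of_hasCompactSupport hs1.mul_left)
    (((hC hf).continuous.mul hχ.continuous).integrable_of_hasCompactSupport hsupp.mul_left)
    (fun q _ => (hC hf).differentiable (by simp) q) (fun q _ => hχ.differentiable (by simp) q)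
  simp only [hd hχ] at e1
  simp only [hd hf] at e2
  rw [e1, e2, neg_neg]

theorem integral_mul_leviForm {f χ : ℂ × ℂ → ℝ} (hf : ContDiff ℝ 2 f) (hχ : ContDiff ℝ 2 χ)
    (hsupp : HasCompactSupport χ) (b : ℂ × ℂ) :
    ∫ q, f q * leviForm χ q b = ∫ q, leviForm f q b * χ q := by
  have hcont : ∀ {g : ℂ × ℂ → ℝ}, ContDiff ℝ 2 g → ∀ v,
      Continuous fun q => fderiv ℝ (fderiv ℝ g) q v v := fun hg v =>
    ((((hg.fderiv_right (m := 1) (by norm_num)).fderiv_right (m := 0)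
      (by norm_num)).continuous).clm_apply continuous_const).clm_apply continuous_const
  have hs : ∀ v, HasCompactSupport fun q => fderiv ℝ (fderiv ℝ χ) q v v := fun v =>
    ((hsupp.fderiv (𝕜 := ℝ)).fderiv (𝕜 := ℝ)).comp_left
      (g := fun L : ℂ × ℂ →L[ℝ] ℂ × ℂ →L[ℝ] ℝ => L v v) rfl
  simp only [leviForm_eq_fderiv hχ, leviForm_eq_fderiv hf, mul_add, add_mul]
  have hi1 : ∀ v, MeasureTheory.Integrable fun q => f q * fderiv ℝ (fderiv ℝ χ) q v v := fun v =>
    (hf.continuous.mul (hcont hχ v)).integrable_of_hasCompactSupport (hs v).mul_left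
  have hi2 : ∀ v, MeasureTheory.Integrable fun q => fderiv ℝ (fderiv ℝ f) q v v * χ q := fun v =>
    ((hcont hf v).mul hχ.continuous).integrable_of_hasCompactSupport hsupp.mul_left
  have : (MeasureTheory.volume : MeasureTheory.Measure (ℂ × ℂ)).IsAddHaarMeasure :=
    inferInstanceAs ((MeasureTheory.volume : MeasureTheory.Measure ℂ).prod
      MeasureTheory.volume).IsAddHaarMeasure
  rw [MeasureTheory.integral_add (hi1 _) (hi1 _), MeasureTheory.integral_add (hi2 _) (hi2 _),
    integral_mul_fderiv_fderiv hf hχ hsupp, integral_mul_fderiv_fderiv hf hχ hsupp]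

/-- `2 log ‖z‖` is pluriharmonic for `‖z‖ > R`, in the sense of distributions. -/
theorem integral_log_mul_leviForm {χ : ℂ × ℂ → ℝ} (hχ : ContDiff ℝ ∞ χ)
    (hsupp : HasCompactSupport χ) {R : ℝ} (hR : 0 < R) (hsub : ∀ q ∈ tsupport χ, R < ‖q.1‖)
    (b : ℂ × ℂ) : ∫ q, 2 * Real.log ‖q.1‖ * leviForm χ q b = 0 := by
  -- The cutoff is `0` for `|z|² ≤ R²/2` and `1` for `|z| ≥ R`: it removes the singularity at `0`
  -- without changing anything on the support of `χ`, so that integration by parts applies.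
  set F : ℂ → ℝ := fun z => Real.smoothTransition (2 * ‖z‖ ^ 2 / R ^ 2 - 1) * (2 * Real.log ‖z‖)
    with hF
  have hFeq : ∀ z : ℂ, R < ‖z‖ → F z = 2 * Real.log ‖z‖ := fun z hz => by
    have h1 : 1 ≤ 2 * ‖z‖ ^ 2 / R ^ 2 - 1 := by
      rw [le_sub_iff_add_le, le_div_iff₀ (by positivity)]
      nlinarith
    rw [hF]
    simp only [Real.smoothTransition.one_of_one_le h1, one_mul]
  have hFC : ContDiff ℝ 2 F := by
    rw [contDiff_iff_contDiffAt]
    intro z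
    by_cases hz : z = 0
    · have h1 : ∀ᶠ ξ : ℂ in 𝓝 z, 2 * ‖ξ‖ ^ 2 / R ^ 2 - 1 < 0 :=
        ContinuousAt.eventually_lt (by fun_prop) continuousAt_const (by simp [hz])
      refine (contDiffAt_const (c := (0 : ℝ))).congr_of_eventuallyEq ?_
      filter_upwards [h1] with ξ hξ
      rw [hF]
      simp only [Real.smoothTransition.zero_of_nonpos hξ.le, zero_mul]
    · refine ContDiffAt.mul (ContDiff.contDiffAt ?_) (contDiffAt_const.mul ?_)
      · exact Real.smoothTransition.contDiff.comp
          (((contDiff_const.mul (contDiff_norm_sq ℝ)).div_const _).sub contDiff_const)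
      · exact (AnalyticAt.harmonicAt_log_norm analyticAt_id hz).1
  have hχ2 : ContDiff ℝ 2 χ := hχ.of_le (WithTop.coe_le_coe.2 le_top)
  have h1 : ∫ q : ℂ × ℂ, 2 * Real.log ‖q.1‖ * leviForm χ q b
      = ∫ q : ℂ × ℂ, F q.1 * leviForm χ q b := by
    refine MeasureTheory.integral_congr_ae (Filter.Eventually.of_forall fun q => ?_)
    by_cases hq : q ∈ tsupport χ
    · simp only [hFeq _ (hsub q hq)]
    · simp only [leviForm_eq_zero_of_notMem_tsupport hq, mul_zero]
  rw [h1, integral_mul_leviForm (f := fun q : ℂ × ℂ => F q.1) (hFC.comp contDiff_fst) hχ2 hsupp]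
  refine MeasureTheory.integral_eq_zero_of_ae (Filter.Eventually.of_forall fun q => ?_)
  by_cases hq : q ∈ tsupport χ
  · have hz := hsub q hq
    have hcont : Continuous fun ζ : ℂ => ‖q.1 + ζ * b.1‖ := by fun_prop
    have hz0 : q.1 + 0 * b.1 ≠ 0 := by
      rw [zero_mul, add_zero]
      exact norm_pos_iff.1 (hR.trans hz)
    have hharm : InnerProductSpace.HarmonicAt (fun ζ : ℂ => Real.log ‖q.1 + ζ * b.1‖) 0 :=
      AnalyticAt.harmonicAt_log_norm (by fun_prop) hz0
    have h2 : (fun ζ : ℂ => F (q + ζ • b).1) =ᶠ[𝓝 0]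
        (2 : ℝ) • fun ζ : ℂ => Real.log ‖q.1 + ζ * b.1‖ := by
      have h3 : ∀ᶠ ζ : ℂ in 𝓝 0, R < ‖q.1 + ζ * b.1‖ :=
        continuousAt_const.eventually_lt hcont.continuousAt (by simpa using hz)
      filter_upwards [h3] with ζ hζ
      exact hFeq _ hζ
    have h4 : leviForm (fun q : ℂ × ℂ => F q.1) q b = 0 := by
      rw [leviForm, (InnerProductSpace.laplacian_congr_nhds h2).eq_of_nhds,
        InnerProductSpace.laplacian_smul _ hharm.1, hharm.2.eq_of_nhds]
      simp
    simp [h4]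
  · simp [image_eq_zero_of_notMem_tsupport hq]

/-! ### The current is not identically zero. -/

section BumpOnDisc

/-- The derivative of `expNegInvGlue`. -/
noncomputable def glueDeriv (y : ℝ) : ℝ := (y⁻¹) ^ 2 * expNegInvGlue y

/-- The second derivative of `expNegInvGlue`. -/
noncomputable def glueDeriv₂ (y : ℝ) : ℝ := ((y⁻¹) ^ 4 - 2 * (y⁻¹) ^ 3) * expNegInvGlue y

theorem hasDerivAt_expNegInvGlue (y : ℝ) : HasDerivAt expNegInvGlue (glueDeriv y) y := by
  have := expNegInvGlue.hasDerivAt_polynomial_eval_inv_mul 1 y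
  simpa [glueDeriv] using this

theorem hasDerivAt_glueDeriv (y : ℝ) : HasDerivAt glueDeriv (glueDeriv₂ y) y := by
  have h := expNegInvGlue.hasDerivAt_polynomial_eval_inv_mul (Polynomial.X ^ 2) y
  simp only [Polynomial.eval_mul, Polynomial.eval_pow, Polynomial.eval_X, Polynomial.eval_sub,
    Polynomial.derivative_X_pow, Polynomial.eval_C] at h
  refine h.congr_deriv ?_
  simp only [glueDeriv₂, Nat.cast_ofNat, Nat.add_one_sub_one, pow_one]
  ring

theorem continuous_glueDeriv : Continuous glueDeriv :=
  continuous_iff_continuousAt.2 fun y => (hasDerivAt_glueDeriv y).continuousAt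

theorem continuous_glueDeriv₂ : Continuous glueDeriv₂ := by
  have := expNegInvGlue.continuous_polynomial_eval_inv_mul
    (Polynomial.X ^ 4 - 2 * Polynomial.X ^ 3)
  refine this.congr fun y => ?_
  simp [glueDeriv₂]

variable (A P : ℝ)

/-- A bump function on `ℂ` supported in `‖w‖² ≤ P`. -/
noncomputable def discBump (w : ℂ) : ℝ := expNegInvGlue ((P - ‖w‖ ^ 2) / A)

/-- The Laplacian of `discBump`. -/
noncomputable def discBumpLaplacian (w : ℂ) : ℝ :=
  4 * ‖w‖ ^ 2 / A ^ 2 * glueDeriv₂ ((P - ‖w‖ ^ 2) / A) - 4 / A * glueDeriv ((P - ‖w‖ ^ 2) / A)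

theorem contDiff_discBump : ContDiff ℝ ∞ (discBump A P) := by
  unfold discBump
  exact expNegInvGlue.contDiff.comp ((contDiff_const.sub (contDiff_norm_sq ℝ)).div_const _)

theorem continuous_discBumpLaplacian : Continuous (discBumpLaplacian A P) := by
  have h1 := continuous_glueDeriv
  have h2 := continuous_glueDeriv₂
  unfold discBumpLaplacian
  fun_prop

theorem laplacian_discBump (w : ℂ) :
    Laplacian.laplacian (discBump A P) w = discBumpLaplacian A P w := by
  have hC : ContDiff ℝ 2 (discBump A P) := (contDiff_discBump A P).of_le
    (WithTop.coe_le_coe.2 le_top)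
  have key : ∀ (a n : ℝ) (v : ℂ), (∀ t : ℝ, ‖w + t • v‖ ^ 2 = (a + t) ^ 2 + n) →
      fderiv ℝ (fderiv ℝ (discBump A P)) w v v
        = 4 * a ^ 2 / A ^ 2 * glueDeriv₂ ((P - ‖w‖ ^ 2) / A)
          - 2 / A * glueDeriv ((P - ‖w‖ ^ 2) / A) := by
    intro a n v hv
    have hY : ∀ t : ℝ, HasDerivAt (fun t : ℝ => (P - ((a + t) ^ 2 + n)) / A)
        (-(2 * (a + t)) / A) t := fun t =>
      (((hasDerivAt_add_sq a t).add_const n).const_sub P).div_const A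
    have hw : ‖w‖ ^ 2 = a ^ 2 + n := by simpa using hv 0
    refine fderiv_fderiv_eq_of_line hC.contDiffAt
      (g₁ := fun t => glueDeriv ((P - ((a + t) ^ 2 + n)) / A) * (-(2 * (a + t)) / A)) ?_ ?_
    · refine Filter.Eventually.of_forall fun t => ?_
      simp only [discBump, hv]
      exact (hasDerivAt_expNegInvGlue _).comp t (hY t)
    · have h1 := ((hasDerivAt_glueDeriv _).comp 0 (hY 0)).mul
        ((hasDerivAt_two_mul_add a 0).neg.div_const A)
      refine h1.congr_deriv ?_
      simp only [Function.comp_apply, Pi.neg_apply, add_zero, hw]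
      ring
  rw [laplacian_eq_fderiv, key w.re (w.im ^ 2) 1 (fun t => by simp [norm_sq_eq_re_im]),
    key w.im (w.re ^ 2) Complex.I (fun t => by simp [norm_sq_eq_re_im]; ring), discBumpLaplacian,
    norm_sq_eq_re_im]
  ring

theorem discBumpLaplacian_eq_zero (hA : 0 < A) {w : ℂ} (hw : P ≤ ‖w‖ ^ 2) :
    discBumpLaplacian A P w = 0 := by
  have h : expNegInvGlue ((P - ‖w‖ ^ 2) / A) = 0 :=
    expNegInvGlue.zero_of_nonpos (div_nonpos_of_nonpos_of_nonneg (by linarith) hA.le)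
  simp [discBumpLaplacian, glueDeriv, glueDeriv₂, h]

/-- With `s = |w|²`, the Laplacian is a positive factor times `s - (P² - s²)/A`, which is positive
as soon as `P² ≤ Aσ ≤ As`. A large `A` thus confines the negative part of the Laplacian to the disc
`|w|² < σ`. -/
theorem discBumpLaplacian_pos {σ : ℝ} (hσ : 0 < σ) (hA : 0 < A) (hP : P ^ 2 ≤ A * σ) {w : ℂ}
    (hw : σ ≤ ‖w‖ ^ 2) (hwP : ‖w‖ ^ 2 < P) : 0 < discBumpLaplacian A P w := by
  set s := ‖w‖ ^ 2
  set y := (P - s) / A with hy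
  have hy0 : 0 < y := div_pos (by linarith) hA
  have h1 : discBumpLaplacian A P w
      = 4 / (A ^ 2 * y ^ 4) * (s * (1 - 2 * y) - A * y ^ 2) * expNegInvGlue y := by
    change 4 * s / A ^ 2 * glueDeriv₂ y - 4 / A * glueDeriv y = _
    clear_value s y
    simp only [glueDeriv, glueDeriv₂]
    field_simp
  have h2 : s * (1 - 2 * y) - A * y ^ 2 = s - (P ^ 2 - s ^ 2) / A := by
    rw [hy]
    field_simp
    ring
  have h3 : (P ^ 2 - s ^ 2) / A < s := by
    rw [div_lt_iff₀ hA]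
    nlinarith
  rw [h1, h2]
  exact mul_pos (mul_pos (by positivity) (by linarith)) (expNegInvGlue.pos_of_pos hy0)

theorem discBumpLaplacian_nonneg {σ : ℝ} (hσ : 0 < σ) (hA : 0 < A) (hP : P ^ 2 ≤ A * σ) {w : ℂ}
    (hw : σ ≤ ‖w‖ ^ 2) : 0 ≤ discBumpLaplacian A P w := by
  rcases lt_or_ge (‖w‖ ^ 2) P with h | h
  · exact (discBumpLaplacian_pos A P hσ hA hP hw h).le
  · exact (discBumpLaplacian_eq_zero A P hA h).ge

end BumpOnDisc

/-- A nonnegative function on `ℂ × 𝔻` that vanishes near the origin and is positive somewhere far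
away is not weakly harmonic in the first variable. -/
theorem not_weakly_harmonic {u : ℂ × ℂ → ℝ} {r : ℝ} (hr : 0 < r)
    (hloc : MeasureTheory.LocallyIntegrableOn u (Set.univ ×ˢ Metric.ball 0 1))
    (hnonneg : ∀ q : ℂ × ℂ, ‖q.2‖ < 1 → 0 ≤ u q)
    (hzero : ∀ q : ℂ × ℂ, ‖q.2‖ < 1 / 2 → ‖q.1‖ ≤ r → u q = 0)
    (hpos : ∀ q : ℂ × ℂ, ‖q.2‖ < 1 → 1 < ‖q.1‖ → 0 < u q) :
    ∃ χ : ℂ × ℂ → ℝ, ContDiff ℝ ∞ χ ∧ HasCompactSupport χ ∧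
      tsupport χ ⊆ Set.univ ×ˢ Metric.ball 0 1 ∧ ∫ q, u q * leviForm χ q (1, 0) ≠ 0 := by
  set σ : ℝ := r ^ 2 with hσdef
  have hσ : 0 < σ := by positivity
  -- With `σ = r²`, the part where the bump may have negative Laplacian lies in the zero set of `u`.
  -- Taking `P > 1 + σ` leaves an annulus beyond `|w| = 1` on which both `u` and the Laplacian are
  -- positive.
  set P : ℝ := 2 + σ with hPdef
  have hP0 : 0 < P := by positivity
  set A : ℝ := P ^ 2 / σ with hAdef
  have hA : 0 < A := by positivity
  have hAP : P ^ 2 ≤ A * σ := by rw [hAdef, div_mul_cancel₀ _ hσ.ne']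
  let β : ContDiffBump (0 : ℂ) := ⟨1 / 8, 1 / 4, by norm_num, by norm_num⟩
  set K : Set (ℂ × ℂ) := Metric.closedBall 0 P ×ˢ Metric.closedBall 0 (1 / 4) with hK
  have hKc : IsCompact K := (isCompact_closedBall 0 P).prod (isCompact_closedBall 0 (1 / 4))
  have hKsub : K ⊆ Set.univ ×ˢ Metric.ball 0 1 := fun q hq =>
    ⟨Set.mem_univ _, Metric.closedBall_subset_ball (by norm_num) hq.2⟩
  have hlarge : ∀ w : ℂ, w ∉ Metric.closedBall (0 : ℂ) P → P ≤ ‖w‖ ^ 2 := fun w hw => by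
    rw [mem_closedBall_zero_iff, not_le] at hw
    nlinarith
  have hβzero : ∀ τ : ℂ, τ ∉ Metric.ball (0 : ℂ) (1 / 4) → β τ = 0 := fun τ hτ => by
    have h := β.support_eq
    by_contra h0
    exact hτ (h ▸ Function.mem_support.2 h0)
  set χ : ℂ × ℂ → ℝ := fun q => discBump A P q.1 * β q.2 with hχ
  have hχsupp : Function.support χ ⊆ K := by
    intro q hq
    by_contra hqK
    rw [hK, Set.mem_prod, not_and_or] at hqK
    refine hq ?_
    rcases hqK with h | h
    · have h1 : discBump A P q.1 = 0 := expNegInvGlue.zero_of_nonpos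
        (div_nonpos_of_nonpos_of_nonneg (by linarith [hlarge _ h]) hA.le)
      simp [hχ, h1]
    · simp [hχ, hβzero _ fun h1 => h (Metric.ball_subset_closedBall h1)]
  have hlevi : ∀ q : ℂ × ℂ, leviForm χ q (1, 0) = discBumpLaplacian A P q.1 * β q.2 := fun q => by
    have h1 : (fun ζ : ℂ => χ (q + ζ • ((1, 0) : ℂ × ℂ)))
        = β q.2 • (discBump A P ∘ fun ζ : ℂ => q.1 + ζ) := by
      funext ζ
      simp [hχ, mul_comm]
    have h2 : AnalyticAt ℂ (fun ζ : ℂ => q.1 + ζ) 0 := by fun_prop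
    have hC : ContDiff ℝ 2 (discBump A P) := (contDiff_discBump A P).of_le
      (WithTop.coe_le_coe.2 le_top)
    have h3 : deriv (fun ζ : ℂ => q.1 + ζ) 0 = 1 := by simp
    rw [leviForm, h1, InnerProductSpace.laplacian_smul _
      (hC.contDiffAt.comp _ (contDiffAt_real_of_analyticAt h2)),
      laplacian_comp_analytic h2 hC.contDiffAt, laplacian_discBump, h3]
    simp [mul_comm]
  refine ⟨χ, ((contDiff_discBump A P).comp contDiff_fst).mul (β.contDiff.comp contDiff_snd),
    HasCompactSupport.of_support_subset_isCompact hKc hχsupp,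
    (closure_minimal hχsupp hKc.isClosed).trans hKsub, fun h0 => ?_⟩
  simp only [hlevi] at h0
  set G : ℂ × ℂ → ℝ := fun q => u q * (discBumpLaplacian A P q.1 * β q.2) with hG
  have hGnonneg : 0 ≤ G := fun q => by
    by_cases hq : q.2 ∈ Metric.ball (0 : ℂ) (1 / 4)
    · have hq' : ‖q.2‖ < 1 / 4 := mem_ball_zero_iff.1 hq
      rcases le_or_gt ‖q.1‖ r with h1 | h1
      · simp [hG, hzero q (by linarith) h1]
      · refine mul_nonneg (hnonneg q (by linarith)) (mul_nonneg ?_ β.nonneg)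
        refine discBumpLaplacian_nonneg A P hσ hA hAP ?_
        rw [hσdef]
        gcongr
    · simp [hG, hβzero _ hq]
  have hGint : MeasureTheory.Integrable G := by
    have hcont : Continuous fun q : ℂ × ℂ => discBumpLaplacian A P q.1 * β q.2 :=
      ((continuous_discBumpLaplacian A P).comp continuous_fst).mul
        (β.continuous.comp continuous_snd)
    rw [← MeasureTheory.integrableOn_iff_integrable_of_support_subset (s := K)]
    · exact (hloc.integrableOn_compact_subset hKsub hKc).mul_continuousOn hcont.continuousOn hKc
    · intro q hq
      by_contra hqK
      rw [hK, Set.mem_prod, not_and_or] at hqK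
      refine hq ?_
      rcases hqK with h | h
      · simp [hG, discBumpLaplacian_eq_zero A P hA (hlarge _ h)]
      · simp [hG, hβzero _ fun h1 => h (Metric.ball_subset_closedBall h1)]
  have hae := (MeasureTheory.integral_eq_zero_iff_of_nonneg hGnonneg hGint).1 h0
  -- A nonempty open set on which the nonnegative integrand is strictly positive, which is
  -- incompatible with a zero integral.
  set O : Set (ℂ × ℂ) := {q | 1 + σ < ‖q.1‖ ^ 2 ∧ ‖q.1‖ ^ 2 < P ∧ ‖q.2‖ < 1 / 8} with hO
  have hOopen : IsOpen O := by
    have h1 : IsOpen {q : ℂ × ℂ | 1 + σ < ‖q.1‖ ^ 2} := isOpen_lt (by fun_prop) (by fun_prop)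
    have h2 : IsOpen {q : ℂ × ℂ | ‖q.1‖ ^ 2 < P} := isOpen_lt (by fun_prop) (by fun_prop)
    have h3 : IsOpen {q : ℂ × ℂ | ‖q.2‖ < 1 / 8} := isOpen_lt (by fun_prop) (by fun_prop)
    exact h1.inter (h2.inter h3)
  have hOne : O.Nonempty := by
    refine ⟨((Real.sqrt (3 / 2 + σ) : ℝ), 0), ?_⟩
    simp only [hO, Set.mem_ofPred_eq, Complex.norm_real, norm_zero, Real.norm_eq_abs, sq_abs]
    rw [Real.sq_sqrt (by positivity)]
    refine ⟨by linarith, by linarith, by norm_num⟩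
  have hOpos : ∀ q ∈ O, 0 < G q := fun q hq => by
    obtain ⟨h1, h2, h3⟩ := hq
    refine mul_pos (hpos q (by linarith) (by nlinarith [norm_nonneg q.1])) (mul_pos ?_ ?_)
    · exact discBumpLaplacian_pos A P hσ hA hAP (by linarith) h2
    · exact β.pos_of_mem_ball (mem_ball_zero_iff.2 (h3.trans (by
        change (1 / 8 : ℝ) < 1 / 4
        norm_num)))
  have hnull : MeasureTheory.volume O = 0 := by
    refine MeasureTheory.measure_mono_null (fun q hq => ?_) (MeasureTheory.ae_iff.1 hae)
    exact (hOpos q hq).ne'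
  exact (hOopen.measure_pos MeasureTheory.volume hOne).ne' hnull

/-! ### Degeneracy near `w = 0` and failure of maximal rank. -/

/-- The part of `P1 × 𝔻` with `|z| > R` and `|τ| < 1 / 2`. -/
def nearInfinity (R : ℝ) : Set (P1 × ℂ) :=
  ((↑) '' Metric.closedBall (0 : ℂ) R : Set P1)ᶜ ×ˢ Metric.ball 0 (1 / 2)

theorem isOpen_nearInfinity (R : ℝ) : IsOpen (nearInfinity R) :=
  (OnePoint.isOpen_compl_image_coe.2
    ⟨Metric.isClosed_closedBall, isCompact_closedBall 0 R⟩).prod Metric.isOpen_ball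

theorem nonempty_nearInfinity (R : ℝ) : (nearInfinity R).Nonempty :=
  ⟨(OnePoint.infty, 0), by simp, by simp⟩

theorem nearInfinity_subset (R : ℝ) : nearInfinity R ⊆ openProduct := fun _ hp =>
  ⟨Set.mem_univ _, Metric.ball_subset_ball (by norm_num) hp.2⟩

theorem chartZ_mem_nearInfinity {R : ℝ} {z τ : ℂ} :
    (chartZ z, τ) ∈ nearInfinity R ↔ R < ‖z‖ ∧ ‖τ‖ < 1 / 2 := by
  simp [nearInfinity, chartZ]

theorem norm_lt_of_chartW_mem_nearInfinity {R : ℝ} (hR : 0 < R) {w τ : ℂ}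
    (h : (chartW w, τ) ∈ nearInfinity R) : ‖w‖ < R⁻¹ ∧ ‖τ‖ < 1 / 2 := by
  rcases eq_or_ne w 0 with rfl | hw
  · exact ⟨by simpa using hR, mem_ball_zero_iff.1 h.2⟩
  · rw [chartW_of_ne hw, chartZ_mem_nearInfinity, norm_inv] at h
    exact ⟨(lt_inv_comm₀ hR (norm_pos_iff.2 hw)).1 h.1, h.2⟩

/-- The current of `Φ` vanishes on a neighbourhood of `∞` on which the local potential in the
coordinate `w` is zero. -/
theorem currentVanishesOn_nearInfinity {Φ : P1 × ℂ → ℝ} {R : ℝ} (hR : 0 < R)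
    (h : ∀ w τ : ℂ, ‖w‖ < R⁻¹ → ‖τ‖ < 1 / 2 → fsPotential w + Φ (chartW w, τ) = 0) :
    CurrentVanishesOn Φ (nearInfinity R) := by
  have hopen : ∀ c ∈ charts, IsOpen {q : ℂ × ℂ | (c q.1, q.2) ∈ nearInfinity R} := fun c hc =>
    (isOpen_nearInfinity R).preimage
      (((isOpenEmbedding_chart hc).continuous.comp continuous_fst).prodMk continuous_snd)
  have key : ∀ c ∈ charts, ∀ f : ℂ × ℂ → ℝ,
      ContinuousOn f {q | (c q.1, q.2) ∈ nearInfinity R} →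
      (∀ q : ℂ × ℂ, (c q.1, q.2) ∈ nearInfinity R → fsPotential q.1 + Φ (c q.1, q.2) = f q) →
      (∀ χ : ℂ × ℂ → ℝ, ContDiff ℝ ∞ χ → HasCompactSupport χ →
        tsupport χ ⊆ {q | (c q.1, q.2) ∈ nearInfinity R} →
          ∀ b : ℂ × ℂ, ∫ q, f q * leviForm χ q b = 0) →
      MeasureTheory.LocallyIntegrableOn
        (fun q : ℂ × ℂ => fsPotential q.1 + Φ (c q.1, q.2))
        {q | (c q.1, q.2) ∈ nearInfinity R} ∧
      ∀ χ : ℂ × ℂ → ℝ, ContDiff ℝ ∞ χ → HasCompactSupport χ →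
        tsupport χ ⊆ {q | (c q.1, q.2) ∈ nearInfinity R} →
          ∀ b : ℂ × ℂ, ∫ q : ℂ × ℂ, (fsPotential q.1 + Φ (c q.1, q.2)) * leviForm χ q b = 0 := by
    intro c hc f hf heq hint
    refine ⟨(ContinuousOn.congr hf heq).locallyIntegrableOn (hopen c hc).measurableSet,
      fun χ hχ hsupp hsub b => ?_⟩
    rw [← hint χ hχ hsupp hsub b]
    refine MeasureTheory.integral_congr_ae (Filter.Eventually.of_forall fun q => ?_)
    by_cases hq : q ∈ tsupport χ
    · simp only [heq q (hsub hq)]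
    · simp [leviForm_eq_zero_of_notMem_tsupport hq]
  intro c hc
  rcases hc with rfl | rfl
  · have hmem : ∀ q ∈ {q : ℂ × ℂ | (chartZ q.1, q.2) ∈ nearInfinity R},
        R < ‖q.1‖ ∧ ‖q.2‖ < 1 / 2 := fun q hq => chartZ_mem_nearInfinity.1 hq
    -- A zero potential in the coordinate `w` becomes `2 log|z|` in the coordinate `z`, by the
    -- transition formula `fsPotential_inv`.
    refine key chartZ (by simp [charts]) (fun q => 2 * Real.log ‖q.1‖) ?_ ?_ ?_
    · exact continuousOn_const.mul ((continuous_fst.norm.continuousOn).log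
        fun q hq => (hR.trans (hmem q hq).1).ne')
    · intro q hq
      obtain ⟨h1, h2⟩ := hmem q hq
      have hne : q.1 ≠ 0 := norm_pos_iff.1 (hR.trans h1)
      have h3 := h q.1⁻¹ q.2
        (by rw [norm_inv]; exact (inv_lt_inv₀ (hR.trans h1) hR).2 h1) h2
      rw [chartW_of_ne (inv_ne_zero hne), inv_inv, fsPotential_inv hne] at h3
      linarith
    · exact fun χ hχ hsupp hsub b =>
        integral_log_mul_leviForm hχ hsupp hR (fun q hq => (hmem q (hsub hq)).1) b
  · refine key chartW (by simp [charts]) (fun _ => 0) continuousOn_const ?_ (by simp)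
    intro q hq
    obtain ⟨h1, h2⟩ := norm_lt_of_chartW_mem_nearInfinity hR hq
    exact h _ _ h1 h2

/-- A function on `P1` whose local potential vanishes on a disc does not define a strictly positive
current. -/
theorem not_isStrictlyPositive {f : P1 → ℝ} {r : ℝ} (hr : 0 < r)
    (h : ∀ w : ℂ, ‖w‖ ≤ r → fsPotential w + f (chartW w) = 0) : ¬ IsStrictlyPositive f := by
  rintro ⟨ε, hε, hpsh⟩
  -- On `|w| = r` the potential of `(1 - ε) ω_FS + dd^c f` is the negative constant `-ε log(1 +
  -- r²)`, yet it is `0` at the centre: the sub-mean value inequality fails.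
  have hmean := (hpsh chartW (by simp [charts])).2.2 0 (r : ℂ) (fun _ _ => Set.mem_univ _)
    (fun _ => -ε * Real.log (1 + r ^ 2)) continuousOn_const (fun ζ hζ => by
      have hn : ‖ζ * (r : ℂ)‖ = r := by
        rw [norm_mul, mem_sphere_zero_iff_norm.1 hζ, one_mul, Complex.norm_real, Real.norm_eq_abs,
          abs_of_pos hr]
      have h1 := h (ζ * r) hn.le
      have h2 : fsPotential (ζ * r) = Real.log (1 + r ^ 2) := by rw [fsPotential, hn]
      rw [zero_add, smul_eq_mul, EReal.coe_le_coe_iff, ← h2]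
      linarith)
  rw [Real.circleAverage_const, EReal.coe_le_coe_iff] at hmean
  have h0 := h 0 (by simpa using hr.le)
  have hlog : 0 < Real.log (1 + r ^ 2) := Real.log_pos (by nlinarith)
  have h1 : (1 - ε) * fsPotential 0 + f (chartW 0) = 0 := by
    rw [fsPotential_zero] at h0 ⊢
    linarith
  rw [h1] at hmean
  nlinarith

namespace IsProfile

variable {H : ℂ → ℝ} {ρ : ℝ}

/-- A product neighbourhood inside the region `|w| ≤ ρ(1 - |τ|²)`: for `|τ| < 1/2` the right side is
at least `3ρ/4`. -/
theorem potential_eq_zero_of_le_half (hH : IsProfile H ρ) {Φ : P1 × ℂ → ℝ}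
    (hΦ : IsWeakSolution (rotatedPotential H) Φ) {w τ : ℂ} (hw : ‖w‖ ≤ ρ / 2)
    (hτ : ‖τ‖ < 1 / 2) : fsPotential w + Φ (chartW w, τ) = 0 := by
  refine hH.potential_eq_zero hΦ (by linarith) (hw.trans ?_)
  have h1 : ‖τ‖ ^ 2 ≤ 1 / 4 := by nlinarith [norm_nonneg τ]
  nlinarith [hH.pos]

theorem not_currentVanishesOn_openProduct (hH : IsProfile H ρ) {Φ : P1 × ℂ → ℝ}
    (hΦ : IsWeakSolution (rotatedPotential H) Φ) : ¬ CurrentVanishesOn Φ openProduct := by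
  intro hvan
  obtain ⟨hloc, hint⟩ := hvan chartW (by simp [charts])
  have hset : {q : ℂ × ℂ | (chartW q.1, q.2) ∈ openProduct} = Set.univ ×ˢ Metric.ball 0 1 := by
    ext q
    simp [openProduct]
  rw [hset] at hloc hint
  obtain ⟨χ, hχ, hsupp, hsub, hne⟩ := not_weakly_harmonic (half_pos hH.pos) hloc
    (fun q hq => hH.potential_nonneg hΦ q.1 hq.le)
    (fun q hτ hw => hH.potential_eq_zero_of_le_half hΦ hw hτ) (fun q hτ hw => by
      -- The bound with `δ = 1` is `log((1 + |w|²)/2)`, which is positive for `|w| > 1`.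
      have h1 := hH.lower_bound hΦ one_pos le_rfl q.1 hτ.le
      have h2 : Real.log (1 + 1) < Real.log (1 + 1 * ‖q.1‖ ^ 2) :=
        Real.log_lt_log (by norm_num) (by nlinarith)
      linarith)
  exact hne (hint χ hχ hsupp hsub (1, 0))

end IsProfile

end HMAE

theorem theorem1p1 :
    ∃ φ : Circle → HMAE.P1 → ℝ,
      HMAE.IsSmoothFamily φ ∧ (∀ τ : Circle, HMAE.IsKahlerPotential (φ τ)) ∧
      ∃ Φ : HMAE.P1 × ℂ → ℝ, HMAE.IsWeakSolution φ Φ ∧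
        (∃ S : Set (HMAE.P1 × ℂ), IsOpen S ∧ S.Nonempty ∧ S ⊆ HMAE.openProduct ∧
          HMAE.CurrentVanishesOn Φ S) ∧
        ¬ HMAE.HasMaximalRank Φ ∧
        ¬ HMAE.CurrentVanishesOn Φ HMAE.openProduct := by
  obtain ⟨H, ρ, hH⟩ := HMAE.exists_profile
  obtain ⟨L, hL⟩ := hH.exists_lipschitz
  obtain ⟨Φ, hΦ⟩ := HMAE.exists_isWeakSolution hH.isKahlerPotential hL
  have hρ := half_pos hH.pos
  refine ⟨HMAE.rotatedPotential H, hH.isSmoothFamily, hH.isKahlerPotential, Φ, hΦ,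
    -- The condition `|z| > (ρ/2)⁻¹` is `|w| < ρ/2` in the other coordinate.
    ⟨HMAE.nearInfinity (ρ / 2)⁻¹, HMAE.isOpen_nearInfinity _, HMAE.nonempty_nearInfinity _,
      HMAE.nearInfinity_subset _, HMAE.currentVanishesOn_nearInfinity (inv_pos.2 hρ) ?_⟩,
    fun hmax => ?_, hH.not_currentVanishesOn_openProduct hΦ⟩
  · intro w τ hw hτ
    rw [inv_inv] at hw
    exact hH.potential_eq_zero_of_le_half hΦ hw.le hτ
  · exact HMAE.not_isStrictlyPositive hρ
      (fun w hw => hH.potential_eq_zero_of_le_half hΦ hw (by simp))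
      (hmax 0 (by simp))
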